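/- Let $n\ge 1$. Write $S^{n-1}$ for the unit sphere of $\mathbb{R}^n$, $du$ for integration with respect to spherical Lebesgue measure (i.e. $(n-1)$-dimensional Hausdorff measure) on $S^{n-1}$, and $V_n$ for volume. Let $\mathcal{K}_o^n$ be the set of compact convex sets in $\mathbb{R}^n$ containing the origin $o$ in their interiors. For $K\in\mathcal{K}_o^n$ let $h_K(v)=\sup_{x\in K}\langle v,x\rangle$ be its support function, and for a set $M$ star-shaped about $o$ (with $o\in M$) let $\rho_M(u)=\sup\{t>0: tu\in M\}$, $u\in S^{n-1}$, be its radial function. A star body is a set star-shaped about $o$ whose radial function is positive (finite) and continuous on $S^{n-1}$. For $K\in\mathcal{K}_o^n$ and almost every $u\in S^{n-1}$, let $\alpha_K(u)$ be the unique $v\in S^{n-1}$ with $\langle v,\rho_K(u)u\rangle=h_K(v)$, i.e. the outer unit normal of $K$ at the boundary point $\rho_K(u)u$. Let $K,L\in\mathcal{K}_o^n$, let $Q$ be a star body in $\mathbb{R}^n$, and let $\varphi,\psi:(0,\infty)\to(0,\infty)$ be increasing (not necessarily strictly) and convex. Define $$\widetilde{V}_{\varphi,\psi}(K,L,Q)=\frac1n\int_{S^{n-1}}\varphi\!\left(\psi\!\left(\frac{h_L(\alpha_K(u))}{h_K(\alpha_K(u))}\right)\left(\frac{\rho_K(u)}{\rho_Q(u)}\right)^n\right)\rho_Q(u)^n\,du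 .$$ Then $$\widetilde{V}_{\varphi,\psi}(K,L,Q)\ \ge\ \varphi\!\left(\frac{V_n(K)}{V_n(Q)}\,\psi\!\left(\left(\frac{V_n(L)}{V_n(K)}\right)^{1/n}\right)\right)V_n(Q).$$ If, in addition, $\varphi$ and $\psi$ are strictly convex and $Q$ is closed, then equality holds if and only if $K$, $L$ and $Q$ are dilatates of each other, i.e. each is a positive multiple $cM$, $c>0$, of each other one $M$. -/

import Mathlib

open MeasureTheory Set
open scoped Pointwise

namespace DualOrlicz

/-- The support function `h_K(v) = sup_{x ∈ K} ⟨v, x⟩`. -/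
noncomputable def supportFunction {n : ℕ} (K : Set (EuclideanSpace ℝ (Fin n)))
    (v : EuclideanSpace ℝ (Fin n)) : ℝ :=
  sSup ((fun x => inner ℝ v x) '' K)

/-- The radial function `ρ_K(u) = sup {t > 0 : t u ∈ K}`. -/
noncomputable def radialFunction {n : ℕ} (K : Set (EuclideanSpace ℝ (Fin n)))
    (u : EuclideanSpace ℝ (Fin n)) : ℝ :=
  sSup {t : ℝ | 0 < t ∧ t • u ∈ K}

/-- A set that is star-shaped about the origin and whose radial function is positive and continuous
on the unit sphere. (A positive value of `radialFunction` is a genuine supremum of a nonempty set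
that is bounded above; boundedness on the sphere follows by compactness.) -/
structure IsStarBody {n : ℕ} (Q : Set (EuclideanSpace ℝ (Fin n))) : Prop where
  zero_mem : (0 : EuclideanSpace ℝ (Fin n)) ∈ Q
  starConvex : StarConvex ℝ 0 Q
  radial_pos : ∀ u ∈ Metric.sphere (0 : EuclideanSpace ℝ (Fin n)) 1, 0 < radialFunction Q u
  radial_continuousOn :
    ContinuousOn (radialFunction Q) (Metric.sphere (0 : EuclideanSpace ℝ (Fin n)) 1)

/-- The supporting hyperplane `H(K, v) = {x : ⟨v, x⟩ = h_K(v)}`. -/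
def supportingHyperplane {n : ℕ} (K : Set (EuclideanSpace ℝ (Fin n)))
    (v : EuclideanSpace ℝ (Fin n)) : Set (EuclideanSpace ℝ (Fin n)) :=
  {x | inner ℝ v x = supportFunction K v}

/-- The multivalued radial Gauss map: the set of all outer unit normal vectors of `K` at the
boundary point `ρ_K(u) u`. -/
def radialGaussImage {n : ℕ} (K : Set (EuclideanSpace ℝ (Fin n)))
    (u : Metric.sphere (0 : EuclideanSpace ℝ (Fin n)) 1) :
    Set (Metric.sphere (0 : EuclideanSpace ℝ (Fin n)) 1) :=
  {v | radialFunction K (u : EuclideanSpace ℝ (Fin n)) • (u : EuclideanSpace ℝ (Fin n)) ∈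
    supportingHyperplane K (v : EuclideanSpace ℝ (Fin n))}

open Classical in
/-- The radial Gauss map `α_K(u)`: the outer unit normal vector of `K` at `ρ_K(u) u`, where it is
unique. For a convex body with the origin in its interior it is unique for almost all `u`; on the
exceptional null set a placeholder value is used. -/
noncomputable def radialGaussMap {n : ℕ} (K : Set (EuclideanSpace ℝ (Fin n)))
    (u : Metric.sphere (0 : EuclideanSpace ℝ (Fin n)) 1) :
    Metric.sphere (0 : EuclideanSpace ℝ (Fin n)) 1 :=
  if h : ∃! v, v ∈ radialGaussImage K u then h.choose else u

/-- The `(φ, ψ)`-mixed volume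
`(1/n) ∫_{S^{n-1}} φ(ψ(h_L(α_K(u)) / h_K(α_K(u))) (ρ_K(u) / ρ_Q(u))^n) ρ_Q(u)^n du`.
Integration is with respect to the spherical Lebesgue measure on the unit sphere, of total mass
`n` times the volume of the unit ball. -/
noncomputable def mixedVolume {n : ℕ} (φ ψ : ℝ → ℝ)
    (K L Q : Set (EuclideanSpace ℝ (Fin n))) : ℝ :=
  (1 / (n : ℝ)) * ∫ u : Metric.sphere (0 : EuclideanSpace ℝ (Fin n)) 1,
    φ (ψ (supportFunction L (radialGaussMap K u : EuclideanSpace ℝ (Fin n)) /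
          supportFunction K (radialGaussMap K u : EuclideanSpace ℝ (Fin n))) *
        (radialFunction K (u : EuclideanSpace ℝ (Fin n)) /
          radialFunction Q (u : EuclideanSpace ℝ (Fin n))) ^ n) *
      radialFunction Q (u : EuclideanSpace ℝ (Fin n)) ^ n
    ∂(volume : Measure (EuclideanSpace ℝ (Fin n))).toSphere

/-- `A` and `B` are dilatates of each other. -/
def AreDilatates {n : ℕ} (A B : Set (EuclideanSpace ℝ (Fin n))) : Prop :=
  ∃ c : ℝ, 0 < c ∧ B = c • A

end DualOrlicz

/-! The gauge of K is Lipschitz, hence differentiable at almost every direction u. Its gradient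
there is an outer normal of K at `ρ_K(u) u`, scaled so that `h_K` equals 1 on it. The ratio `h_L /
h_K` is 0-homogeneous, so at `α_K(u)` it equals G(u) := h_L(∇gauge_K(u)).

Put m = (V(L)/V(K))^(1/n). Minkowski's first inequality says that the mean of G with weight `ρ_K^n`
is at least m (`minkowski_first_inequality`). It comes from Brunn–Minkowski by a first-order
expansion of the volume of a Minkowski combination in polar coordinates. Jensen for ψ with weight
`ρ_K^n`, then Jensen for φ with weight `ρ_Q^n`, joined by monotonicity, give the bound
(`map_map_mul_integral_le`), because `(ρ_K/ρ_Q)^n ρ_Q^n = ρ_K^n`.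

In the equality case, strict convexity makes G = m and `ρ_K/ρ_Q` constant almost everywhere.
Constancy of the ratio makes Q a dilatate of K. The equality case of Minkowski's inequality is not
needed: G = m already gives `ρ_L ≤ m ρ_K` almost everywhere, and V(L) = m^n V(K) turns this into
equality (`eq_smul_of_supportFunction_ae_eq`). -/

namespace DualOrlicz

/-! ### Brunn–Minkowski in multiplicative form, via Prékopa–Leindler. -/

section BrunnMinkowski

open scoped ENNReal

/-- C contains the translates A + min B and max A + B, which meet only in the point max A + min B.
-/
theorem volume_add_volume_le_of_isCompact {A B C : Set ℝ} (hA : IsCompact A) (hB : IsCompact B)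
    (hAne : A.Nonempty) (hBne : B.Nonempty) (h : ∀ x ∈ A, ∀ y ∈ B, x + y ∈ C) :
    volume A + volume B ≤ volume C := by
  have ha := hA.sSup_mem hAne
  have hb := hB.sInf_mem hBne
  set a := sSup A
  set b := sInf B
  have h1 : volume ((fun x => x + b) '' A) = volume A := by
    rw [image_add_right, measure_preimage_add_right]
  have h2 : volume ((fun x => a + x) '' B) = volume B := by
    rw [image_add_left, measure_preimage_add]
  have hd : AEDisjoint volume ((fun x => x + b) '' A) ((fun x => a + x) '' B) := by
    refine measure_mono_null (t := {a + b}) ?_ (by simp)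
    rintro _ ⟨⟨x, hx, rfl⟩, ⟨y, hy, hxy⟩⟩
    have := le_csSup hA.bddAbove hx
    have := csInf_le hB.bddBelow hy
    simp only [mem_singleton_iff]
    simp only at hxy
    linarith
  rw [← h1, ← h2, ← measure_union₀ (hB.image (by fun_prop)).measurableSet.nullMeasurableSet hd]
  apply measure_mono
  rintro _ (⟨x, hx, rfl⟩ | ⟨y, hy, rfl⟩)
  · exact h x hx b hb
  · exact h a ha y hy

/-- Inner regularity; a fixed point is inserted into each compact subset because the compact case
needs nonempty sets. -/
theorem volume_add_volume_le {A B C : Set ℝ} (hA : MeasurableSet A) (hB : MeasurableSet B)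
    (hAne : A.Nonempty) (hBne : B.Nonempty) (h : ∀ x ∈ A, ∀ y ∈ B, x + y ∈ C) :
    volume A + volume B ≤ volume C := by
  obtain ⟨x₀, hx₀⟩ := hAne
  obtain ⟨y₀, hy₀⟩ := hBne
  rw [hA.measure_eq_iSup_isCompact, hB.measure_eq_iSup_isCompact]
  simp only [iSup_and']
  refine ENNReal.biSup_add_biSup_le' ⟨∅, by simp⟩ ⟨∅, by simp⟩ ?_
  rintro K ⟨hKA, hK⟩ K' ⟨hKB, hK'⟩
  refine (add_le_add (measure_mono (subset_insert x₀ K))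
    (measure_mono (subset_insert y₀ K'))).trans ?_
  exact volume_add_volume_le_of_isCompact (hK.insert x₀) (hK'.insert y₀) (insert_nonempty _ _)
    (insert_nonempty _ _) fun x hx y hy =>
      h x (insert_subset hx₀ hKA hx) y (insert_subset hy₀ hKB hy)

theorem rpow_mul_rpow_le_add_ennreal {a b : ℝ} (ha : 0 < a) (hb : 0 < b) (hab : a + b = 1)
    (x y : ℝ≥0∞) : x ^ a * y ^ b ≤ ENNReal.ofReal a * x + ENNReal.ofReal b * y := by
  rcases eq_or_ne x ⊤ with rfl | hx
  · simp [ENNReal.mul_top, ha]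
  rcases eq_or_ne y ⊤ with rfl | hy
  · simp [ENNReal.mul_top, hb]
  lift x to NNReal using hx
  lift y to NNReal using hy
  rw [← ENNReal.coe_rpow_of_nonneg _ ha.le, ← ENNReal.coe_rpow_of_nonneg _ hb.le,
    ENNReal.ofReal, ENNReal.ofReal]
  norm_cast
  rw [← NNReal.coe_le_coe]
  push_cast
  rw [Real.coe_toNNReal _ ha.le, Real.coe_toNNReal _ hb.le]
  exact Real.geom_mean_le_arith_mean2_weighted ha.le hb.le x.2 y.2 hab

/-- The normalized one-dimensional Prékopa–Leindler inequality. -/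
theorem lintegral_add_lintegral_le_of_iSup_eq_one {a b : ℝ} (ha : 0 < a) (hb : 0 < b)
    {f g h : ℝ → ℝ} (hf : Measurable f) (hg : Measurable g) (hh : Measurable h)
    (hf0 : ∀ x, 0 ≤ f x) (hg0 : ∀ x, 0 ≤ g x) (hh0 : ∀ x, 0 ≤ h x)
    (hf1 : ∀ x, f x ≤ 1) (hg1 : ∀ x, g x ≤ 1)
    (hfs : ∀ t < 1, ∃ x, t < f x) (hgs : ∀ t < 1, ∃ x, t < g x)
    (hab : a + b = 1) (hfg : ∀ x y, f x ^ a * g y ^ b ≤ h (a * x + b * y)) :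
    ENNReal.ofReal a * (∫⁻ x, ENNReal.ofReal (f x)) +
      ENNReal.ofReal b * (∫⁻ x, ENNReal.ofReal (g x)) ≤ ∫⁻ x, ENNReal.ofReal (h x) := by
  -- Layer cake. Superlevel sets at heights t ≥ 1 are empty, so only 0 < t < 1 counts; there the
  -- superlevel sets of f and g are nonempty, and a{f > t} + b{g > t} ⊆ {h > t}.
  have key : ∀ k : ℝ → ℝ, Measurable k → (∀ x, 0 ≤ k x) → (∀ x, k x ≤ 1) →
      ∫⁻ x, ENNReal.ofReal (k x) = ∫⁻ t in Ioo (0 : ℝ) 1, volume {x | t < k x} := by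
    intro k hk hk0 hk1
    rw [lintegral_eq_lintegral_meas_lt volume (ae_of_all _ hk0) hk.aemeasurable,
      ← Ioo_union_Ici_eq_Ioi (zero_lt_one' ℝ), lintegral_union measurableSet_Ici
        (Set.disjoint_left.2 fun x hx hx' => absurd hx.2 (not_lt.2 hx')),
      setLIntegral_congr_fun (g := fun _ => 0) measurableSet_Ici]
    · simp
    · intro t ht
      have : {x | t < k x} = ∅ := by
        ext x
        simpa using (hk1 x).trans ht
      simp [this]
  have hm : ∀ k : ℝ → ℝ, Measurable fun t : ℝ => volume {x | t < k x} := fun k =>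
    (show Antitone fun t : ℝ => volume {x | t < k x} from
      fun s t hst => measure_mono fun x (hx : t < k x) => hst.trans_lt hx).measurable
  rw [key f hf hf0 hf1, key g hg hg0 hg1, ← lintegral_const_mul _ (hm f),
    ← lintegral_const_mul _ (hm g), ← lintegral_add_left ((hm f).const_mul _),
    lintegral_eq_lintegral_meas_lt volume (ae_of_all _ hh0) hh.aemeasurable]
  refine (setLIntegral_mono' measurableSet_Ioo ?_).trans
    (lintegral_mono_set (Ioo_subset_Ioi_self : Ioo (0 : ℝ) 1 ⊆ Ioi 0))
  rintro t ⟨ht0, ht1⟩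
  have e1 : ENNReal.ofReal a * volume {x | t < f x} = volume (a • {x | t < f x}) := by
    simp [Measure.addHaar_smul, abs_of_pos ha]
  have e2 : ENNReal.ofReal b * volume {x | t < g x} = volume (b • {x | t < g x}) := by
    simp [Measure.addHaar_smul, abs_of_pos hb]
  rw [e1, e2]
  refine volume_add_volume_le ((measurableSet_lt measurable_const hf).const_smul₀ a)
    ((measurableSet_lt measurable_const hg).const_smul₀ b)
    (Set.Nonempty.smul_set (hfs t ht1)) (Set.Nonempty.smul_set (hgs t ht1)) ?_
  rintro _ ⟨x, hx, rfl⟩ _ ⟨y, hy, rfl⟩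
  refine lt_of_lt_of_le ?_ (hfg x y)
  calc t = t ^ a * t ^ b := by rw [← Real.rpow_add ht0, hab, Real.rpow_one]
    _ < f x ^ a * g y ^ b := mul_lt_mul'' (Real.rpow_lt_rpow ht0.le hx ha)
        (Real.rpow_lt_rpow ht0.le hy hb) (by positivity) (by positivity)

/-- The one-dimensional Prékopa–Leindler inequality for bounded functions. -/
theorem lintegral_rpow_mul_lintegral_rpow_le {a b : ℝ} (ha : 0 < a) (hb : 0 < b)
    {f g h : ℝ → ℝ} (hf : Measurable f) (hg : Measurable g) (hh : Measurable h)
    (hf0 : ∀ x, 0 ≤ f x) (hg0 : ∀ x, 0 ≤ g x) (hh0 : ∀ x, 0 ≤ h x)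
    (hf1 : BddAbove (range f)) (hg1 : BddAbove (range g))
    (hab : a + b = 1) (hfg : ∀ x y, f x ^ a * g y ^ b ≤ h (a * x + b * y)) :
    (∫⁻ x, ENNReal.ofReal (f x)) ^ a * (∫⁻ x, ENNReal.ofReal (g x)) ^ b ≤
      ∫⁻ x, ENNReal.ofReal (h x) := by
  have hfp : ∀ x, f x ≤ ⨆ x, f x := le_ciSup hf1
  have hgq : ∀ x, g x ≤ ⨆ x, g x := le_ciSup hg1
  have hps : ∀ t < ⨆ x, f x, ∃ x, t < f x := fun t ht => exists_lt_of_lt_ciSup ht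
  have hqs : ∀ t < ⨆ x, g x, ∃ x, t < g x := fun t ht => exists_lt_of_lt_ciSup ht
  generalize (⨆ x, f x) = p at hfp hps
  generalize (⨆ x, g x) = q at hgq hqs
  have hp : 0 ≤ p := (hf0 0).trans (hfp 0)
  have hq : 0 ≤ q := (hg0 0).trans (hgq 0)
  rcases hp.eq_or_lt with rfl | hp
  · simp [fun x => ENNReal.ofReal_of_nonpos (hfp x), ENNReal.zero_rpow_of_pos ha]
  rcases hq.eq_or_lt with rfl | hq
  · simp [fun x => ENNReal.ofReal_of_nonpos (hgq x), ENNReal.zero_rpow_of_pos hb]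
  have hc : 0 < p ^ a * q ^ b := by positivity
  -- Dividing f and g by their suprema p, q, and h by p^a q^b, preserves the hypothesis. The
  -- weighted AM–GM inequality then turns the additive bound into the multiplicative one.
  have main := lintegral_add_lintegral_le_of_iSup_eq_one ha hb (hf.div_const p) (hg.div_const q)
    (hh.div_const (p ^ a * q ^ b)) (fun x => div_nonneg (hf0 x) hp.le)
    (fun x => div_nonneg (hg0 x) hq.le) (fun x => div_nonneg (hh0 x) hc.le)
    (fun x => (div_le_one hp).2 (hfp x)) (fun x => (div_le_one hq).2 (hgq x))
    (fun t ht => (hps (t * p) (mul_lt_of_lt_one_left hp ht)).imp fun x hx => (lt_div_iff₀ hp).2 hx)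
    (fun t ht => (hqs (t * q) (mul_lt_of_lt_one_left hq ht)).imp fun x hx => (lt_div_iff₀ hq).2 hx)
    hab (fun x y => by
      rw [Real.div_rpow (hf0 x) hp.le, Real.div_rpow (hg0 y) hq.le, div_mul_div_comm]
      exact div_le_div_of_nonneg_right (hfg x y) hc.le)
  have scale : ∀ (k : ℝ → ℝ) (c : ℝ), 0 < c → Measurable k →
      ∫⁻ x, ENNReal.ofReal (k x) = ENNReal.ofReal c * ∫⁻ x, ENNReal.ofReal (k x / c) := by
    intro k c hc hk
    rw [← lintegral_const_mul _ (hk.div_const c).ennreal_ofReal]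
    refine lintegral_congr fun x => ?_
    rw [← ENNReal.ofReal_mul hc.le, mul_div_cancel₀ _ hc.ne']
  rw [scale f p hp hf, scale g q hq hg, scale h _ hc hh, ENNReal.mul_rpow_of_nonneg _ _ ha.le,
    ENNReal.mul_rpow_of_nonneg _ _ hb.le, mul_mul_mul_comm, ENNReal.ofReal_mul (by positivity),
    ENNReal.ofReal_rpow_of_pos hp, ENNReal.ofReal_rpow_of_pos hq]
  gcongr
  exact (rpow_mul_rpow_le_add_ennreal ha hb hab _ _).trans main

/-- The multiplicative Brunn–Minkowski inequality for compact sets. -/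
theorem pi_volume_rpow_mul_volume_rpow_le {a b : ℝ} (ha : 0 < a) (hb : 0 < b) (hab : a + b = 1)
    (n : ℕ) {A B : Set (Fin n → ℝ)} (hA : IsCompact A) (hB : IsCompact B) :
    volume A ^ a * volume B ^ b ≤ volume (a • A + b • B) := by
  induction n with
  | zero =>
    rcases A.eq_empty_or_nonempty with rfl | hAne
    · simp [ENNReal.zero_rpow_of_pos ha]
    rcases B.eq_empty_or_nonempty with rfl | hBne
    · simp [ENNReal.zero_rpow_of_pos hb]
    rw [Subsingleton.eq_univ_of_nonempty hAne, Subsingleton.eq_univ_of_nonempty hBne,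
      Subsingleton.eq_univ_of_nonempty (s := a • univ + b • univ)
        (univ_nonempty.smul_set.add univ_nonempty.smul_set)]
    rw [Measure.volume_pi_eq_dirac fun i => i.elim0]
    simp
  | succ n ih =>
    -- Slices at first coordinate s. With C = aA + bB, aS_A(s) + bS_B(t) ⊆ S_C(as + bt), so by
    -- induction the slice volumes satisfy the hypothesis of the one-dimensional inequality; Fubini
    -- recovers the volumes.
    let S : Set (Fin (n + 1) → ℝ) → ℝ → Set (Fin n → ℝ) := fun A s => {y | Fin.cons s y ∈ A}
    have hcons : ∀ s : ℝ, Continuous fun y : Fin n → ℝ => (Fin.cons s y : Fin (n + 1) → ℝ) :=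
      fun s => by fun_prop
    have hS : ∀ {A}, IsCompact A → ∀ s, S A s ⊆ Fin.tail '' A := fun _ s y hy =>
      ⟨_, hy, Fin.tail_cons (α := fun _ => ℝ) s y⟩
    have htail : Continuous (Fin.tail : (Fin (n + 1) → ℝ) → (Fin n → ℝ)) := by
      unfold Fin.tail; fun_prop
    have hSc : ∀ {A}, IsCompact A → ∀ s, IsCompact (S A s) := fun hA s =>
      (hA.image htail).of_isClosed_subset (hA.isClosed.preimage (hcons s)) (hS hA s)
    have hvol : ∀ {A}, IsCompact A → volume A = ∫⁻ s, volume (S A s) ∧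
        Measurable fun s => volume (S A s) := by
      intro A hA
      have e := (volume_preserving_piFinSuccAbove (fun _ : Fin (n + 1) => ℝ) 0).symm
      have hm := hA.measurableSet.preimage e.measurable
      have h1 := measurable_measure_prodMk_left (ν := (volume : Measure (Fin n → ℝ))) hm
      have hSe : ∀ s, Prod.mk s ⁻¹'
          ((MeasurableEquiv.piFinSuccAbove (fun _ : Fin (n + 1) => ℝ) 0).symm ⁻¹' A) = S A s := by
        intro s
        ext y
        simp [S, MeasurableEquiv.piFinSuccAbove_symm_apply]
        rfl
      simp only [hSe] at h1
      refine ⟨?_, h1⟩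
      rw [← e.measure_preimage_equiv, Measure.volume_eq_prod, Measure.prod_apply hm]
      simp only [hSe]
    have hfin : ∀ {A}, IsCompact A → ∀ s, volume (S A s) ≠ ⊤ := fun hA s =>
      (hSc hA s).measure_ne_top
    have hint : ∀ {A}, IsCompact A → volume A = ∫⁻ s, ENNReal.ofReal (volume.real (S A s)) :=
      fun hA => by
        simp only [measureReal_def, ENNReal.ofReal_toReal (hfin hA _)]
        exact (hvol hA).1
    have hbdd : ∀ {A}, IsCompact A → BddAbove (range fun s => volume.real (S A s)) := by
      rintro A hA
      refine ⟨volume.real (Fin.tail '' A), ?_⟩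
      rintro _ ⟨s, rfl⟩
      exact measureReal_mono (hS hA s) (hA.image htail).measure_ne_top
    have hC : IsCompact (a • A + b • B) := (hA.smul a).add (hB.smul b)
    rw [hint hA, hint hB, hint hC]
    refine lintegral_rpow_mul_lintegral_rpow_le ha hb (hvol hA).2.ennreal_toReal
      (hvol hB).2.ennreal_toReal (hvol hC).2.ennreal_toReal (fun _ => measureReal_nonneg)
      (fun _ => measureReal_nonneg) (fun _ => measureReal_nonneg) (hbdd hA) (hbdd hB) hab ?_
    intro s t
    rw [measureReal_def, measureReal_def, measureReal_def, ENNReal.toReal_rpow,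
      ENNReal.toReal_rpow, ← ENNReal.toReal_mul]
    refine ENNReal.toReal_mono (hfin hC _) ((ih (hSc hA s) (hSc hB t)).trans (measure_mono ?_))
    rintro _ ⟨_, ⟨x, hx, rfl⟩, _, ⟨y, hy, rfl⟩, rfl⟩
    refine ⟨_, ⟨_, hx, rfl⟩, _, ⟨_, hy, rfl⟩, ?_⟩
    ext i
    refine Fin.cases ?_ (fun i => ?_) i <;> simp

theorem volume_rpow_mul_volume_rpow_le {a b : ℝ} (ha : 0 < a) (hb : 0 < b) (hab : a + b = 1)
    {n : ℕ} {A B : Set (EuclideanSpace ℝ (Fin n))} (hA : IsCompact A) (hB : IsCompact B) :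
    volume A ^ a * volume B ^ b ≤ volume (a • A + b • B) := by
  have e := (EuclideanSpace.volume_preserving_symm_measurableEquiv_toLp (Fin n)).symm
  rw [← e.measure_preimage_equiv, ← e.measure_preimage_equiv B,
    ← e.measure_preimage_equiv (a • A + b • B)]
  have hc : ∀ {A : Set (EuclideanSpace ℝ (Fin n))}, IsCompact A →
      IsCompact ((WithLp.toLp 2 : (Fin n → ℝ) → _) ⁻¹' A) := fun hA =>
    (EuclideanSpace.equiv (Fin n) ℝ).symm.toHomeomorph.isCompact_preimage.2 hA
  refine (pi_volume_rpow_mul_volume_rpow_le ha hb hab n (hc hA) (hc hB)).trans (measure_mono ?_)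
  rintro _ ⟨_, ⟨x, hx, rfl⟩, _, ⟨y, hy, rfl⟩, rfl⟩
  exact ⟨_, ⟨_, hx, rfl⟩, _, ⟨_, hy, rfl⟩, rfl⟩

end BrunnMinkowski

/-! ### Volume in polar coordinates. -/

section Polar

open scoped ENNReal
open Metric Measure Module

variable {E : Type*} [NormedAddCommGroup E] [NormedSpace ℝ E] [FiniteDimensional ℝ E]
  [Nontrivial E] [MeasurableSpace E] [BorelSpace E] (μ : Measure E) [μ.IsAddHaarMeasure]

/-- The origin is null, and a measure-preserving equivalence respects the measure of every set, so M
need not be measurable. -/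
theorem measure_eq_toSphere_prod (M : Set E) :
    μ M = (μ.toSphere.prod (volumeIoiPow (finrank ℝ E - 1)))
      {p : sphere (0 : E) 1 × Ioi (0 : ℝ) | (p.2 : ℝ) • (p.1 : E) ∈ M} := by
  have e : MeasurePreserving (homeomorphUnitSphereProd E).toMeasurableEquiv (μ.comap (↑))
      (μ.toSphere.prod (volumeIoiPow (finrank ℝ E - 1))) :=
    μ.measurePreserving_homeomorphUnitSphereProd
  rw [← e.measure_preimage_equiv, comap_subtype_coe_apply (measurableSet_singleton _).compl]
  have : (homeomorphUnitSphereProd E).toMeasurableEquiv ⁻¹'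
      {p : sphere (0 : E) 1 × Ioi (0 : ℝ) | (p.2 : ℝ) • (p.1 : E) ∈ M} = (↑) ⁻¹' M := by
    ext ⟨x, hx⟩
    have hx' : ‖x‖ ≠ 0 := by simpa using hx
    simp [smul_smul, hx']
  rw [this, Subtype.image_preimage_coe, inter_comm, ← sdiff_eq,
    measure_sdiff_null (measure_singleton _)]

theorem volumeIoiPow_Iic (n : ℕ) (x : Ioi (0 : ℝ)) :
    volumeIoiPow n (Iic x) = ENNReal.ofReal (x.1 ^ (n + 1) / (n + 1)) := by
  have h : volumeIoiPow n {x} = 0 := by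
    refine withDensity_absolutelyContinuous _ _ ?_
    rw [comap_subtype_coe_apply measurableSet_Ioi]
    simp
  rw [← volumeIoiPow_apply_Iio, ← Iio_insert, insert_eq]
  exact le_antisymm ((measure_union_le _ _).trans (by simp [h])) (measure_mono subset_union_right)

variable {μ}

/-- One-sided, so that it applies to sets whose radial extent is only bounded, and only in almost
every direction. -/
theorem measure_le_lintegral_toSphere {M : Set E} {R : sphere (0 : E) 1 → ℝ} (hR : Measurable R)
    (hpos : ∀ u, 0 < R u)
    (h : ∀ᵐ u : sphere (0 : E) 1 ∂μ.toSphere, ∀ t : ℝ, 0 < t → t • (u : E) ∈ M → t ≤ R u) :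
    μ M ≤ ∫⁻ u, ENNReal.ofReal (R u ^ finrank ℝ E / finrank ℝ E) ∂μ.toSphere := by
  have hd : 0 < finrank ℝ E := finrank_pos
  rw [measure_eq_toSphere_prod μ M]
  have hm : MeasurableSet {p : sphere (0 : E) 1 × Ioi (0 : ℝ) | (p.2 : ℝ) ≤ R p.1} :=
    measurableSet_le (by fun_prop) (by fun_prop)
  calc _ ≤ (μ.toSphere.prod (volumeIoiPow (finrank ℝ E - 1)))
        {p : sphere (0 : E) 1 × Ioi (0 : ℝ) | (p.2 : ℝ) ≤ R p.1} := by
        refine measure_mono_ae ?_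
        filter_upwards [quasiMeasurePreserving_fst.ae h] with p hp hpM using hp _ p.2.2 hpM
    _ = _ := by
        rw [Measure.prod_apply hm]
        refine lintegral_congr fun u => ?_
        have := volumeIoiPow_Iic (finrank ℝ E - 1) ⟨R u, hpos u⟩
        rw [Nat.sub_add_cancel hd, ← Nat.cast_add_one, Nat.sub_add_cancel hd] at this
        rw [← this]
        rfl

theorem lintegral_toSphere_le_measure {M : Set E} {R : sphere (0 : E) 1 → ℝ} (hR : Measurable R)
    (hpos : ∀ u, 0 < R u)
    (h : ∀ᵐ u : sphere (0 : E) 1 ∂μ.toSphere, ∀ t : ℝ, 0 < t → t < R u → t • (u : E) ∈ M) :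
    ∫⁻ u, ENNReal.ofReal (R u ^ finrank ℝ E / finrank ℝ E) ∂μ.toSphere ≤ μ M := by
  have hd : 0 < finrank ℝ E := finrank_pos
  rw [measure_eq_toSphere_prod μ M]
  have hm : MeasurableSet {p : sphere (0 : E) 1 × Ioi (0 : ℝ) | (p.2 : ℝ) < R p.1} :=
    measurableSet_lt (by fun_prop) (by fun_prop)
  calc _ = (μ.toSphere.prod (volumeIoiPow (finrank ℝ E - 1)))
        {p : sphere (0 : E) 1 × Ioi (0 : ℝ) | (p.2 : ℝ) < R p.1} := by
        rw [Measure.prod_apply hm]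
        refine lintegral_congr fun u => ?_
        have := volumeIoiPow_apply_Iio (finrank ℝ E - 1) ⟨R u, hpos u⟩
        rw [Nat.sub_add_cancel hd, ← Nat.cast_add_one, Nat.sub_add_cancel hd] at this
        rw [← this]
        rfl
    _ ≤ _ := by
        refine measure_mono_ae ?_
        filter_upwards [quasiMeasurePreserving_fst.ae h] with p hp hpM using hp _ p.2.2 hpM

end Polar

/-! ### Weighted Jensen inequality and its equality case. -/

section Jensen

variable {α : Type*} [MeasurableSpace α] {μ : Measure α} {φ : ℝ → ℝ} {f w : α → ℝ}

theorem exists_subgradient (hφ : ConvexOn ℝ (Ioi 0) φ) {c : ℝ} (hc : 0 < c) :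
    ∃ m : ℝ, ∀ t, 0 < t → φ c + m * (t - c) ≤ φ t := by
  have hci : c ∈ interior (Ioi (0 : ℝ)) := by simpa using hc
  refine ⟨derivWithin φ (Ioi c) c, fun t ht => ?_⟩
  rcases lt_trichotomy t c with h | rfl | h
  · have h1 := (hφ.slope_le_leftDeriv_of_mem_interior ht hci h).trans
      (hφ.leftDeriv_le_rightDeriv_of_mem_interior hci)
    rw [slope_def_field, div_le_iff₀ (sub_pos.2 h)] at h1
    linarith
  · simp
  · have h1 := hφ.rightDeriv_le_slope_of_mem_interior hci ht h
    rw [slope_def_field, le_div_iff₀ (sub_pos.2 h)] at h1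
    linarith

/-- The supporting line lies below φ at the midpoint of t and c, where strict convexity puts φ
strictly below its chord. -/
theorem exists_strict_subgradient (hφ : StrictConvexOn ℝ (Ioi 0) φ) {c : ℝ} (hc : 0 < c) :
    ∃ m : ℝ, ∀ t, 0 < t → t ≠ c → φ c + m * (t - c) < φ t := by
  obtain ⟨m, hm⟩ := exists_subgradient hφ.convexOn hc
  refine ⟨m, fun t ht htc => ?_⟩
  have h1 := hm ((1 / 2 : ℝ) * t + (1 / 2) * c) (by positivity)
  have h2 := hφ.2 (mem_Ioi.2 ht) (mem_Ioi.2 hc) htc (half_pos (one_pos (α := ℝ)))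
    (half_pos (one_pos (α := ℝ))) (by norm_num)
  simp only [smul_eq_mul] at h2
  linarith

/-- Since c is the weighted mean of f, the linear term integrates to zero. The Jensen deficit is
thus the integral of the gap above a supporting line: nonnegative, and zero only if the gap vanishes
almost everywhere. -/
theorem integral_sub_subgradient (m c : ℝ) (hw : Integrable w μ)
    (hfw : Integrable (fun x => f x * w x) μ) (hφf : Integrable (fun x => φ (f x) * w x) μ)
    (hc : ∫ x, f x * w x ∂μ = c * ∫ x, w x ∂μ) :
    Integrable (fun x => (φ (f x) - (φ c + m * (f x - c))) * w x) μ ∧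
      ∫ x, (φ (f x) - (φ c + m * (f x - c))) * w x ∂μ =
        (∫ x, φ (f x) * w x ∂μ) - φ c * ∫ x, w x ∂μ := by
  have e : (fun x => (φ (f x) - (φ c + m * (f x - c))) * w x) =
      fun x => (φ (f x) * w x - m * (f x * w x)) - (φ c - m * c) * w x := by
    ext x; ring
  rw [e]
  have h1 := hφf.sub (hfw.const_mul m)
  have h2 := hw.const_mul (φ c - m * c)
  refine ⟨h1.sub h2, ?_⟩
  have h3 := integral_sub h1 h2
  have h4 := integral_sub hφf (hfw.const_mul m)
  simp only [Pi.sub_apply] at h3 h4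
  rw [h3, h4, integral_const_mul, integral_const_mul, hc]
  ring

/-- Jensen's inequality with a weight. -/
theorem map_mul_integral_le (hφ : ConvexOn ℝ (Ioi 0) φ) {c : ℝ} (hc0 : 0 < c)
    (hw0 : ∀ᵐ x ∂μ, 0 < w x) (hf0 : ∀ᵐ x ∂μ, 0 < f x) (hw : Integrable w μ)
    (hfw : Integrable (fun x => f x * w x) μ) (hφf : Integrable (fun x => φ (f x) * w x) μ)
    (hc : ∫ x, f x * w x ∂μ = c * ∫ x, w x ∂μ) :
    φ c * ∫ x, w x ∂μ ≤ ∫ x, φ (f x) * w x ∂μ := by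
  obtain ⟨m, hm⟩ := exists_subgradient hφ hc0
  rw [← sub_nonneg, ← (integral_sub_subgradient m c hw hfw hφf hc).2]
  refine integral_nonneg_of_ae ?_
  filter_upwards [hw0, hf0] with x h1 h2
  exact mul_nonneg (sub_nonneg.2 (hm _ h2)) h1.le

/-- The equality case of Jensen's inequality with a weight. -/
theorem ae_eq_of_map_mul_integral_eq (hφ : StrictConvexOn ℝ (Ioi 0) φ) {c : ℝ} (hc0 : 0 < c)
    (hw0 : ∀ᵐ x ∂μ, 0 < w x) (hf0 : ∀ᵐ x ∂μ, 0 < f x) (hw : Integrable w μ)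
    (hfw : Integrable (fun x => f x * w x) μ) (hφf : Integrable (fun x => φ (f x) * w x) μ)
    (hc : ∫ x, f x * w x ∂μ = c * ∫ x, w x ∂μ)
    (heq : ∫ x, φ (f x) * w x ∂μ = φ c * ∫ x, w x ∂μ) :
    ∀ᵐ x ∂μ, f x = c := by
  obtain ⟨m, hm⟩ := exists_strict_subgradient hφ hc0
  obtain ⟨hi, he⟩ := integral_sub_subgradient m c hw hfw hφf hc
  rw [heq, sub_self] at he
  rw [integral_eq_zero_iff_of_nonneg_ae _ hi] at he
  · filter_upwards [hw0, hf0, he] with x h1 h2 h3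
    by_contra h4
    exact (mul_pos (sub_pos.2 (hm _ h2 h4)) h1).ne' h3
  · filter_upwards [hw0, hf0] with x h1 h2
    rcases eq_or_ne (f x) c with h4 | h4
    · simp [h4]
    · exact (mul_pos (sub_pos.2 (hm _ h2 h4)) h1).le

end Jensen

/-! ### Elementary properties of support functions. -/

section SupportFunction

open Filter Topology

variable {n : ℕ} {K L : Set (EuclideanSpace ℝ (Fin n))} {u v : EuclideanSpace ℝ (Fin n)}

theorem inner_le_supportFunction (hL : IsCompact L) {x : EuclideanSpace ℝ (Fin n)} (hx : x ∈ L) :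
    inner ℝ v x ≤ supportFunction L v :=
  le_csSup (hL.image (by fun_prop)).bddAbove (mem_image_of_mem _ hx)

theorem supportFunction_le (hL : L.Nonempty) {b : ℝ} (h : ∀ x ∈ L, inner ℝ v x ≤ b) :
    supportFunction L v ≤ b :=
  csSup_le (hL.image _) (forall_mem_image.2 h)

theorem continuous_supportFunction (hL : IsCompact L) : Continuous (supportFunction L) :=
  hL.continuous_sSup (f := fun v x : EuclideanSpace ℝ (Fin n) => inner ℝ v x) (by
    simp only [Function.HasUncurry.uncurry]; fun_prop)

theorem supportFunction_smul {c : ℝ} (hc : 0 ≤ c) :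
    supportFunction L (c • v) = c * supportFunction L v := by
  rw [supportFunction, supportFunction, ← smul_eq_mul, ← Real.sSup_smul_of_nonneg hc,
    ← image_smul, image_image]
  simp only [inner_smul_left, smul_eq_mul]
  rfl

theorem supportFunction_nonneg (hL : IsCompact L) (h0 : 0 ∈ L) : 0 ≤ supportFunction L v := by
  simpa using inner_le_supportFunction (v := v) hL h0

theorem supportFunction_pos (hL : IsCompact L) (h0 : L ∈ 𝓝 0) (hv : v ≠ 0) :
    0 < supportFunction L v := by
  have h1 : Tendsto (fun t : ℝ => t • v) (𝓝 0) (𝓝 0) := by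
    have : Continuous fun t : ℝ => t • v := by fun_prop
    simpa using this.tendsto 0
  have h2 : ∀ᶠ t in 𝓝[>] (0 : ℝ), t • v ∈ L := (h1.eventually h0).filter_mono nhdsWithin_le_nhds
  obtain ⟨t, ht, ht0⟩ := (h2.and self_mem_nhdsWithin).exists
  refine lt_of_lt_of_le ?_ (inner_le_supportFunction hL ht)
  rw [inner_smul_right]
  exact mul_pos ht0 (real_inner_self_pos.2 hv)

end SupportFunction

/-! ### The gauge, its gradient and the radial Gauss map. -/

section Gauge

open Filter Topology

variable {n : ℕ} {K L : Set (EuclideanSpace ℝ (Fin n))} {u v : EuclideanSpace ℝ (Fin n)}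

theorem gauge_pos_of_isCompact (hKk : IsCompact K) (hK0 : K ∈ 𝓝 0) (hu : u ≠ 0) :
    0 < gauge K u :=
  (gauge_pos (absorbent_nhds_zero hK0) (NormedSpace.isVonNBounded_iff ℝ |>.2 hKk.isBounded)).2 hu

theorem mem_iff_gauge_le_one (hKc : Convex ℝ K) (hKk : IsCompact K) (hK0 : K ∈ 𝓝 0) :
    u ∈ K ↔ gauge K u ≤ 1 := by
  rw [gauge_le_one_iff_mem_closure hKc hK0, hKk.isClosed.closure_eq]

theorem radialFunction_eq_inv_gauge (hKc : Convex ℝ K) (hKk : IsCompact K) (hK0 : K ∈ 𝓝 0)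
    (hu : u ≠ 0) : radialFunction K u = (gauge K u)⁻¹ := by
  have hg := gauge_pos_of_isCompact hKk hK0 hu
  have : {t : ℝ | 0 < t ∧ t • u ∈ K} = Ioc 0 (gauge K u)⁻¹ := by
    ext t
    simp only [mem_ofPred_eq, mem_Ioc]
    refine and_congr_right fun ht => ?_
    rw [mem_iff_gauge_le_one hKc hKk hK0, gauge_smul_of_nonneg ht.le, smul_eq_mul,
      ← le_div_iff₀ hg, one_div]
  rw [radialFunction, this, csSup_Ioc (by positivity)]

theorem isStarBody_of_convex (hKc : Convex ℝ K) (hKk : IsCompact K) (hK0 : K ∈ 𝓝 0) :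
    IsStarBody K := by
  have hne : ∀ u ∈ Metric.sphere (0 : EuclideanSpace ℝ (Fin n)) 1, u ≠ 0 := fun u hu =>
    ne_zero_of_mem_unit_sphere ⟨u, hu⟩
  refine ⟨mem_of_mem_nhds hK0, hKc.starConvex (mem_of_mem_nhds hK0), fun u hu => ?_, ?_⟩
  · rw [radialFunction_eq_inv_gauge hKc hKk hK0 (hne u hu)]
    exact inv_pos.2 (gauge_pos_of_isCompact hKk hK0 (hne u hu))
  · refine ContinuousOn.congr (f := fun u => (gauge K u)⁻¹) ?_ fun u hu =>
      radialFunction_eq_inv_gauge hKc hKk hK0 (hne u hu)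
    exact (continuous_gauge hKc hK0).continuousOn.inv₀ fun u hu =>
      (gauge_pos_of_isCompact hKk hK0 (hne u hu)).ne'

/-- Subadditivity and homogeneity bound each forward difference quotient in direction y by `gauge K
y`. -/
theorem fderiv_gauge_apply_le (hKc : Convex ℝ K) (hK0 : K ∈ 𝓝 0)
    (hd : DifferentiableAt ℝ (gauge K) u) (y : EuclideanSpace ℝ (Fin n)) :
    fderiv ℝ (gauge K) u y ≤ gauge K y := by
  have h := (hd.hasFDerivAt.hasLineDerivAt y).tendsto_slope_zero_right
  refine le_of_tendsto h ?_
  filter_upwards [self_mem_nhdsWithin] with t ht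
  have h1 := gauge_add_le hKc (absorbent_nhds_zero hK0) u (t • y)
  rw [gauge_smul_of_nonneg (le_of_lt ht), smul_eq_mul] at h1
  rw [smul_eq_mul, inv_mul_le_iff₀ ht]
  linarith

/-- Euler's identity for a positively 1-homogeneous function. -/
theorem fderiv_gauge_apply_self (hd : DifferentiableAt ℝ (gauge K) u) :
    fderiv ℝ (gauge K) u u = gauge K u := by
  have h1 : HasDerivAt (fun t : ℝ => gauge K (t • u)) (fderiv ℝ (gauge K) u u) 1 := by
    have h2 : HasDerivAt (fun t : ℝ => t • u) u 1 := by
      simpa using (hasDerivAt_id (1 : ℝ)).smul_const u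
    exact HasFDerivAt.comp_hasDerivAt (l := gauge K) 1 (by simpa using hd.hasFDerivAt) h2
  have h3 : HasDerivAt (fun t : ℝ => t * gauge K u) (gauge K u) 1 := by
    simpa using (hasDerivAt_id (1 : ℝ)).mul_const (gauge K u)
  refine h1.unique (h3.congr_of_eventuallyEq ?_)
  filter_upwards [lt_mem_nhds (zero_lt_one' ℝ)] with t ht
  rw [gauge_smul_of_nonneg ht.le, smul_eq_mul]

theorem inner_gradient_gauge (y : EuclideanSpace ℝ (Fin n)) :
    inner ℝ (gradient (gauge K) u) y = fderiv ℝ (gauge K) u y := by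
  simp [gradient]

theorem supportFunction_gradient_gauge (hKc : Convex ℝ K) (hKk : IsCompact K) (hK0 : K ∈ 𝓝 0)
    (hu : u ≠ 0) (hd : DifferentiableAt ℝ (gauge K) u) :
    supportFunction K (gradient (gauge K) u) = 1 := by
  refine le_antisymm (supportFunction_le ⟨0, mem_of_mem_nhds hK0⟩ fun x hx => ?_) ?_
  · rw [inner_gradient_gauge]
    exact (fderiv_gauge_apply_le hKc hK0 hd x).trans (gauge_le_one_of_mem hx)
  · have hg := gauge_pos_of_isCompact hKk hK0 hu
    have : (gauge K u)⁻¹ • u ∈ K := by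
      rw [mem_iff_gauge_le_one hKc hKk hK0, gauge_smul_of_nonneg (by positivity), smul_eq_mul,
        inv_mul_cancel₀ hg.ne']
    refine le_trans (le_of_eq ?_) (inner_le_supportFunction hKk this)
    rw [inner_gradient_gauge, map_smul, fderiv_gauge_apply_self hd, smul_eq_mul,
      inv_mul_cancel₀ hg.ne']

theorem inner_le_supportFunction_mul_gauge (hKc : Convex ℝ K) (hKk : IsCompact K) (hK0 : K ∈ 𝓝 0)
    (y : EuclideanSpace ℝ (Fin n)) : inner ℝ v y ≤ supportFunction K v * gauge K y := by
  rcases eq_or_ne y 0 with rfl | hy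
  · simp
  have hg := gauge_pos_of_isCompact hKk hK0 hy
  have : (gauge K y)⁻¹ • y ∈ K := by
    rw [mem_iff_gauge_le_one hKc hKk hK0, gauge_smul_of_nonneg (by positivity), smul_eq_mul,
      inv_mul_cancel₀ hg.ne']
  have h := inner_le_supportFunction (v := v) hKk this
  rwa [inner_smul_right, inv_mul_le_iff₀ hg, mul_comm] at h

/-- If v is a unit normal at `ρ_K(u) u`, then `h_K(v) gauge K y - ⟨v, y⟩` is nonnegative and
vanishes at y = u. Its derivative there is zero, so v is a positive multiple of the gradient, fixed
by |v| = 1. This gives existence and uniqueness of the normal at once. -/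
theorem radialGaussMap_eq (hKc : Convex ℝ K) (hKk : IsCompact K) (hK0 : K ∈ 𝓝 0)
    (u : Metric.sphere (0 : EuclideanSpace ℝ (Fin n)) 1)
    (hd : DifferentiableAt ℝ (gauge K) (u : EuclideanSpace ℝ (Fin n))) :
    (radialGaussMap K u : EuclideanSpace ℝ (Fin n)) =
      ‖gradient (gauge K) (u : EuclideanSpace ℝ (Fin n))‖⁻¹ • gradient (gauge K) u := by
  have hu : (u : EuclideanSpace ℝ (Fin n)) ≠ 0 := ne_zero_of_mem_unit_sphere u
  have hg := gauge_pos_of_isCompact hKk hK0 hu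
  set G := gradient (gauge K) (u : EuclideanSpace ℝ (Fin n)) with hG
  have hGu : inner ℝ G (u : EuclideanSpace ℝ (Fin n)) = gauge K u := by
    rw [hG, inner_gradient_gauge, fderiv_gauge_apply_self hd]
  have hG0 : G ≠ 0 := by
    rintro h
    rw [h, inner_zero_left] at hGu
    exact hg.ne hGu
  have hGn : 0 < ‖G‖ := norm_pos_iff.2 hG0
  have hmem : ∀ v : Metric.sphere (0 : EuclideanSpace ℝ (Fin n)) 1, v ∈ radialGaussImage K u ↔
      (v : EuclideanSpace ℝ (Fin n)) = ‖G‖⁻¹ • G := by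
    intro v
    have hv0 : (v : EuclideanSpace ℝ (Fin n)) ≠ 0 := ne_zero_of_mem_unit_sphere v
    have hv1 : ‖(v : EuclideanSpace ℝ (Fin n))‖ = 1 := norm_eq_of_mem_sphere v
    simp only [radialGaussImage, supportingHyperplane, mem_ofPred_eq,
      radialFunction_eq_inv_gauge hKc hKk hK0 hu, inner_smul_right]
    constructor
    · intro h
      have hs := supportFunction_pos hKk hK0 hv0
      set s := supportFunction K v
      have hmin : IsLocalMin (fun y => s * gauge K y - inner ℝ (v : EuclideanSpace ℝ (Fin n)) y)
          (u : EuclideanSpace ℝ (Fin n)) := by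
        refine Eventually.of_forall fun y => ?_
        have h1 := inner_le_supportFunction_mul_gauge (v := v) hKc hKk hK0 y
        rw [inv_mul_eq_iff_eq_mul₀ hg.ne'] at h
        simp only [h]
        linarith
      have hder := (hd.hasFDerivAt.const_mul s).sub
        (innerSL ℝ (v : EuclideanSpace ℝ (Fin n))).hasFDerivAt (x := (u : EuclideanSpace ℝ (Fin n)))
      have hz := hmin.hasFDerivAt_eq_zero hder
      have hvG : (v : EuclideanSpace ℝ (Fin n)) = s • G := by
        refine ext_inner_right ℝ fun y => ?_
        have := DFunLike.congr_fun hz y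
        simp only [sub_apply, smul_apply, smul_eq_mul,
          innerSL_apply_apply, zero_apply] at this
        rw [inner_smul_left, hG, inner_gradient_gauge]
        simp only [conj_trivial]
        linarith
      have : s * ‖G‖ = 1 := by
        rw [← hv1, hvG, norm_smul, Real.norm_of_nonneg hs.le]
      rw [hvG, eq_inv_of_mul_eq_one_left this]
    · intro h
      rw [h, supportFunction_smul (by positivity), inner_smul_left, hGu,
        supportFunction_gradient_gauge hKc hKk hK0 hu hd]
      simp only [conj_trivial]
      field_simp
  have hex : ∃! v, v ∈ radialGaussImage K u := by
    refine ⟨⟨‖G‖⁻¹ • G, by simp [norm_smul, hGn.ne']⟩, (hmem _).2 rfl, fun v hv => ?_⟩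
    exact Subtype.ext ((hmem v).1 hv)
  rw [radialGaussMap, dif_pos hex]
  exact (hmem _).1 hex.choose_spec.1

theorem supportFunction_div_radialGaussMap (hKc : Convex ℝ K) (hKk : IsCompact K) (hK0 : K ∈ 𝓝 0)
    (u : Metric.sphere (0 : EuclideanSpace ℝ (Fin n)) 1)
    (hd : DifferentiableAt ℝ (gauge K) (u : EuclideanSpace ℝ (Fin n))) :
    supportFunction L (radialGaussMap K u : EuclideanSpace ℝ (Fin n)) /
      supportFunction K (radialGaussMap K u : EuclideanSpace ℝ (Fin n)) =
      supportFunction L (gradient (gauge K) (u : EuclideanSpace ℝ (Fin n))) := by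
  have hu : (u : EuclideanSpace ℝ (Fin n)) ≠ 0 := ne_zero_of_mem_unit_sphere u
  have h1 := supportFunction_gradient_gauge hKc hKk hK0 hu hd
  have hG : gradient (gauge K) (u : EuclideanSpace ℝ (Fin n)) ≠ 0 := by
    rintro h
    have h0 := supportFunction_smul (L := K) (v := 0) (le_refl (0 : ℝ))
    rw [smul_zero, zero_mul] at h0
    rw [h, h0] at h1
    exact zero_ne_one h1
  rw [radialGaussMap_eq hKc hKk hK0 u hd, supportFunction_smul (by positivity),
    supportFunction_smul (by positivity), h1, mul_one,
    mul_div_cancel_left₀ _ (inv_ne_zero (norm_ne_zero_iff.2 hG))]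

/-- Rademacher gives differentiability almost everywhere in space. By Fubini almost every ray
contains a point of differentiability, and homogeneity carries it along the ray to u. -/
theorem ae_differentiableAt_gauge (hn : 1 ≤ n) (hKc : Convex ℝ K) (hK0 : K ∈ 𝓝 0) :
    ∀ᵐ u : Metric.sphere (0 : EuclideanSpace ℝ (Fin n)) 1 ∂(volume : Measure _).toSphere,
      DifferentiableAt ℝ (gauge K) (u : EuclideanSpace ℝ (Fin n)) := by
  have : NeZero n := ⟨by omega⟩
  obtain ⟨C, hC⟩ := hKc.lipschitz_gauge hK0
  have h1 : volume {x | ¬ DifferentiableAt ℝ (gauge K) x} = 0 := hC.ae_differentiableAt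
  rw [measure_eq_toSphere_prod] at h1
  set ν := Measure.volumeIoiPow (Module.finrank ℝ (EuclideanSpace ℝ (Fin n)) - 1)
  -- A nonzero ray measure is what lets "almost every t" produce some t.
  have hν : ν ≠ 0 := by
    intro h
    have h2 := Measure.volumeIoiPow_apply_Iio
      (Module.finrank ℝ (EuclideanSpace ℝ (Fin n)) - 1) ⟨1, mem_Ioi.2 one_pos⟩
    change ν _ = _ at h2
    rw [h, Measure.coe_zero, Pi.zero_apply, eq_comm, ENNReal.ofReal_eq_zero] at h2
    exact absurd h2 (not_le.2 (by positivity))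
  have : NeZero ν := ⟨hν⟩
  filter_upwards [Measure.ae_ae_of_ae_prod (ae_iff.2 h1)] with u hu
  obtain ⟨t, ht⟩ := hu.exists
  have ht0 : (0 : ℝ) < t := t.2
  have h2 : DifferentiableAt ℝ (fun x => (t : ℝ)⁻¹ * gauge K ((t : ℝ) • x))
      (u : EuclideanSpace ℝ (Fin n)) := by
    refine DifferentiableAt.const_mul ?_ _
    exact DifferentiableAt.comp (g := gauge K) _ ht (by fun_prop)
  refine h2.congr_of_eventuallyEq (Eventually.of_forall fun x => ?_)
  simp only
  rw [gauge_smul_of_nonneg ht0.le, smul_eq_mul, inv_mul_cancel_left₀ ht0.ne']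

theorem measurable_supportFunction_gradient_gauge (hL : IsCompact L) :
    Measurable fun u : EuclideanSpace ℝ (Fin n) => supportFunction L (gradient (gauge K) u) := by
  refine (continuous_supportFunction hL).measurable.comp ?_
  exact (InnerProductSpace.toDual ℝ _).symm.continuous.measurable.comp (measurable_fderiv ℝ _)

end Gauge

open Filter Topology

/-! ### Star bodies and their radial functions. -/

section StarBody

variable {n : ℕ} {Q Q' : Set (EuclideanSpace ℝ (Fin n))}

theorem IsStarBody.continuous_radialFunction (hQ : IsStarBody Q) :
    Continuous fun u : Metric.sphere (0 : EuclideanSpace ℝ (Fin n)) 1 =>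
      radialFunction Q (u : EuclideanSpace ℝ (Fin n)) :=
  continuousOn_iff_continuous_domRestrict.1 hQ.radial_continuousOn

theorem IsStarBody.radialFunction_pos (hQ : IsStarBody Q)
    (u : Metric.sphere (0 : EuclideanSpace ℝ (Fin n)) 1) :
    0 < radialFunction Q (u : EuclideanSpace ℝ (Fin n)) := hQ.radial_pos u u.2

theorem IsStarBody.le_radialFunction (hQ : IsStarBody Q)
    (u : Metric.sphere (0 : EuclideanSpace ℝ (Fin n)) 1) {t : ℝ} (ht : 0 < t)
    (h : t • (u : EuclideanSpace ℝ (Fin n)) ∈ Q) :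
    t ≤ radialFunction Q (u : EuclideanSpace ℝ (Fin n)) := by
  refine le_csSup ?_ ⟨ht, h⟩
  -- The supremum of an unbounded set is 0 by convention, which positivity of the radial function
  -- excludes.
  by_contra hb
  exact (hQ.radialFunction_pos u).ne' (Real.sSup_of_not_bddAbove hb)

theorem IsStarBody.smul_mem_of_lt (hQ : IsStarBody Q)
    (u : Metric.sphere (0 : EuclideanSpace ℝ (Fin n)) 1) {t : ℝ} (ht : 0 < t)
    (h : t < radialFunction Q (u : EuclideanSpace ℝ (Fin n))) :
    t • (u : EuclideanSpace ℝ (Fin n)) ∈ Q := by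
  have hne : {t : ℝ | 0 < t ∧ t • (u : EuclideanSpace ℝ (Fin n)) ∈ Q}.Nonempty := by
    by_contra hb
    have h0 := hQ.radialFunction_pos u
    rw [radialFunction, not_nonempty_iff_eq_empty.1 hb, Real.sSup_empty] at h0
    exact h0.false
  obtain ⟨s, ⟨hs, hsQ⟩, hts⟩ := exists_lt_of_lt_csSup hne h
  have := hQ.starConvex.smul_mem hsQ (t := t / s) (by positivity) ((div_le_one hs).2 hts.le)
  rwa [smul_smul, div_mul_cancel₀ _ hs.ne'] at this

theorem IsStarBody.smul_mem_iff (hQ : IsStarBody Q) (hQc : IsClosed Q)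
    (u : Metric.sphere (0 : EuclideanSpace ℝ (Fin n)) 1) {t : ℝ} (ht : 0 < t) :
    t • (u : EuclideanSpace ℝ (Fin n)) ∈ Q ↔
      t ≤ radialFunction Q (u : EuclideanSpace ℝ (Fin n)) := by
  refine ⟨hQ.le_radialFunction u ht, fun h => ?_⟩
  have h1 : Tendsto (fun s : ℝ => s • (u : EuclideanSpace ℝ (Fin n))) (𝓝[<] t) (𝓝 (t • u)) := by
    have : Continuous fun s : ℝ => s • (u : EuclideanSpace ℝ (Fin n)) := by fun_prop
    exact (this.tendsto t).mono_left nhdsWithin_le_nhds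
  refine hQc.mem_of_tendsto h1 ?_
  filter_upwards [self_mem_nhdsWithin, nhdsWithin_le_nhds (lt_mem_nhds ht)] with s hs hs0
  exact hQ.smul_mem_of_lt u hs0 (lt_of_lt_of_le hs h)

/-- Closedness puts the radial endpoint in the set, so the radial function determines a closed star
body. -/
theorem IsStarBody.eq_smul (hQ : IsStarBody Q) (hQ' : IsStarBody Q') (hQc : IsClosed Q)
    (hQc' : IsClosed Q') {d : ℝ} (hd : 0 < d)
    (h : ∀ u : Metric.sphere (0 : EuclideanSpace ℝ (Fin n)) 1,
      radialFunction Q' (u : EuclideanSpace ℝ (Fin n)) = d * radialFunction Q u) :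
    Q' = d • Q := by
  ext x
  rw [mem_smul_set_iff_inv_smul_mem₀ hd.ne']
  rcases eq_or_ne x 0 with rfl | hx
  · simp [hQ.zero_mem, hQ'.zero_mem]
  have hx' : 0 < ‖x‖ := norm_pos_iff.2 hx
  let u : Metric.sphere (0 : EuclideanSpace ℝ (Fin n)) 1 :=
    ⟨‖x‖⁻¹ • x, by simp [norm_smul, hx'.ne']⟩
  have hxu : x = ‖x‖ • (u : EuclideanSpace ℝ (Fin n)) := by simp [u, smul_smul, hx'.ne']
  clear_value u
  generalize ‖x‖ = r at hx' hxu
  rw [hxu, smul_smul]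
  rw [hQ'.smul_mem_iff hQc' u hx', hQ.smul_mem_iff hQc u (by positivity), h,
    inv_mul_le_iff₀ hd]

end StarBody

/-! ### Volumes as integrals of powers of the radial function. -/

section Volume

variable {n : ℕ}

theorem integrable_toSphere_of_continuous
    {f : Metric.sphere (0 : EuclideanSpace ℝ (Fin n)) 1 → ℝ} (hf : Continuous f) :
    Integrable f (volume : Measure (EuclideanSpace ℝ (Fin n))).toSphere := by
  have : CompactSpace (Metric.sphere (0 : EuclideanSpace ℝ (Fin n)) 1) :=
    isCompact_iff_compactSpace.1 (isCompact_sphere _ _)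
  exact hf.integrable_of_hasCompactSupport (HasCompactSupport.of_compactSpace f)

theorem volume_real_le_integral (hn : 1 ≤ n) {M : Set (EuclideanSpace ℝ (Fin n))}
    {R : Metric.sphere (0 : EuclideanSpace ℝ (Fin n)) 1 → ℝ} (hR : Measurable R)
    (hpos : ∀ u, 0 < R u)
    (hi : Integrable (fun u => R u ^ n) (volume : Measure (EuclideanSpace ℝ (Fin n))).toSphere)
    (h : ∀ᵐ u : Metric.sphere (0 : EuclideanSpace ℝ (Fin n)) 1 ∂(volume : Measure _).toSphere,
      ∀ t : ℝ, 0 < t → t • (u : EuclideanSpace ℝ (Fin n)) ∈ M → t ≤ R u) :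
    n * volume.real M ≤ ∫ u, R u ^ n ∂(volume : Measure (EuclideanSpace ℝ (Fin n))).toSphere := by
  have : NeZero n := ⟨by omega⟩
  have hn0 : (0 : ℝ) < n := by exact_mod_cast hn
  have h1 := measure_le_lintegral_toSphere hR hpos h
  rw [finrank_euclideanSpace_fin, ← ofReal_integral_eq_lintegral_ofReal (hi.div_const _)
    (ae_of_all _ fun u => by have := hpos u; positivity), integral_div] at h1
  rw [← le_div_iff₀' hn0]
  exact ENNReal.toReal_le_of_le_ofReal
    (div_nonneg (integral_nonneg fun u => (pow_pos (hpos u) n).le) hn0.le) h1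

theorem IsStarBody.volume_real (hn : 1 ≤ n) {Q : Set (EuclideanSpace ℝ (Fin n))}
    (hQ : IsStarBody Q) :
    n * volume.real Q = ∫ u : Metric.sphere (0 : EuclideanSpace ℝ (Fin n)) 1,
      radialFunction Q (u : EuclideanSpace ℝ (Fin n)) ^ n ∂(volume : Measure _).toSphere := by
  have : NeZero n := ⟨by omega⟩
  have hn0 : (0 : ℝ) < n := by exact_mod_cast hn
  have hc := hQ.continuous_radialFunction
  have hi : Integrable (fun u : Metric.sphere (0 : EuclideanSpace ℝ (Fin n)) 1 =>
      radialFunction Q (u : EuclideanSpace ℝ (Fin n)) ^ n) (volume : Measure _).toSphere :=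
    integrable_toSphere_of_continuous (hc.pow n)
  have h1 := measure_le_lintegral_toSphere (μ := volume) hc.measurable hQ.radialFunction_pos
    (ae_of_all _ fun u t ht => hQ.le_radialFunction u ht)
  have h2 := lintegral_toSphere_le_measure (μ := volume) hc.measurable hQ.radialFunction_pos
    (ae_of_all _ fun u t ht => hQ.smul_mem_of_lt u ht)
  have h3 := le_antisymm h1 h2
  rw [finrank_euclideanSpace_fin, ← ofReal_integral_eq_lintegral_ofReal (hi.div_const _)
    (ae_of_all _ fun u => by have := hQ.radialFunction_pos u; positivity), integral_div] at h3
  rw [measureReal_def, h3, ENNReal.toReal_ofReal, mul_div_cancel₀ _ hn0.ne']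
  exact div_nonneg (integral_nonneg fun u => (pow_pos (hQ.radialFunction_pos u) n).le) hn0.le

theorem IsStarBody.integral_pow_pos (hn : 1 ≤ n) {Q : Set (EuclideanSpace ℝ (Fin n))}
    (hQ : IsStarBody Q) :
    0 < ∫ u : Metric.sphere (0 : EuclideanSpace ℝ (Fin n)) 1,
      radialFunction Q (u : EuclideanSpace ℝ (Fin n)) ^ n ∂(volume : Measure _).toSphere := by
  have : NeZero n := ⟨by omega⟩
  have hi := integrable_toSphere_of_continuous (hQ.continuous_radialFunction.pow n)
  rw [integral_pos_iff_support_of_nonneg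
    (fun u => (pow_pos (hQ.radialFunction_pos u) n).le) hi]
  have : (Function.support fun u : Metric.sphere (0 : EuclideanSpace ℝ (Fin n)) 1 =>
      radialFunction Q (u : EuclideanSpace ℝ (Fin n)) ^ n) = univ :=
    eq_univ_of_forall fun u => (pow_pos (hQ.radialFunction_pos u) n).ne'
  rw [this]
  exact (Measure.measure_univ_ne_zero.2 (Measure.toSphere_ne_zero volume)).bot_lt

theorem IsStarBody.volume_real_pos (hn : 1 ≤ n) {Q : Set (EuclideanSpace ℝ (Fin n))}
    (hQ : IsStarBody Q) : 0 < volume.real Q := by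
  have := hQ.integral_pow_pos hn
  rw [← hQ.volume_real hn] at this
  exact pos_of_mul_pos_right this (by positivity)

end Volume

/-! ### Minkowski's first inequality. -/

section Minkowski

variable {n : ℕ} {K L : Set (EuclideanSpace ℝ (Fin n))}

/-- The error constant is uniform in y, so the expansion can be integrated over the sphere. -/
theorem exists_one_add_mul_pow_le (n : ℕ) {B : ℝ} (hB : 0 ≤ B) :
    ∃ C : ℝ, 0 ≤ C ∧ ∀ t y : ℝ, 0 ≤ t → t ≤ 1 → -1 ≤ y → y ≤ B →
      (1 + t * y) ^ n ≤ 1 + n * (t * y) + C * t ^ 2 := by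
  induction n with
  | zero => exact ⟨0, le_rfl, fun t y _ _ _ _ => by simp⟩
  | succ n ih =>
    obtain ⟨C, hC, h⟩ := ih
    refine ⟨n * (1 + B) ^ 2 + C * (1 + B), by positivity, fun t y ht ht1 hy hyB => ?_⟩
    have h1 : 0 ≤ 1 + t * y := by nlinarith
    have h2 : 1 + t * y ≤ 1 + B := by nlinarith
    have h3 : y ^ 2 ≤ (1 + B) ^ 2 := by nlinarith
    have h4 := mul_le_mul_of_nonneg_left (h t y ht ht1 hy hyB) h1
    have h5 : (n : ℝ) * t ^ 2 * y ^ 2 ≤ n * t ^ 2 * (1 + B) ^ 2 := by gcongr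
    have h6 : C * t ^ 2 * (1 + t * y) ≤ C * t ^ 2 * (1 + B) := by gcongr
    push_cast
    rw [pow_succ']
    linarith

theorem exists_supportFunction_gradient_gauge_le (hn : 1 ≤ n) (hKc : Convex ℝ K) (hK0 : K ∈ 𝓝 0)
    (hLk : IsCompact L) (hL : L.Nonempty) :
    ∃ b : ℝ, ∀ᵐ u : Metric.sphere (0 : EuclideanSpace ℝ (Fin n)) 1 ∂(volume : Measure _).toSphere,
      supportFunction L (gradient (gauge K) (u : EuclideanSpace ℝ (Fin n))) ≤ b := by
  obtain ⟨b, hb⟩ := (hLk.image (continuous_gauge hKc hK0)).bddAbove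
  refine ⟨b, ?_⟩
  filter_upwards [ae_differentiableAt_gauge hn hKc hK0] with u hu
  refine supportFunction_le hL fun x hx => ?_
  rw [inner_gradient_gauge]
  exact (fderiv_gauge_apply_le hKc hK0 hu x).trans (hb (mem_image_of_mem _ hx))

/-- Test the gradient against the point `ρ_L(u) u` of L and use Euler's identity. This serves for
the positive lower bound on G and again in the equality case. -/
theorem radialFunction_div_le_supportFunction (hKc : Convex ℝ K) (hKk : IsCompact K)
    (hK0 : K ∈ 𝓝 0) (hLc : Convex ℝ L) (hLk : IsCompact L) (hL0 : L ∈ 𝓝 0)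
    (u : Metric.sphere (0 : EuclideanSpace ℝ (Fin n)) 1)
    (hd : DifferentiableAt ℝ (gauge K) (u : EuclideanSpace ℝ (Fin n))) :
    radialFunction L (u : EuclideanSpace ℝ (Fin n)) / radialFunction K u ≤
      supportFunction L (gradient (gauge K) (u : EuclideanSpace ℝ (Fin n))) := by
  have hLs := isStarBody_of_convex hLc hLk hL0
  have h := inner_le_supportFunction (v := gradient (gauge K) (u : EuclideanSpace ℝ (Fin n))) hLk
    ((hLs.smul_mem_iff hLk.isClosed u (hLs.radialFunction_pos u)).2 le_rfl)
  rwa [inner_gradient_gauge, map_smul, fderiv_gauge_apply_self hd, smul_eq_mul,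
    ← inv_inv (gauge K (u : EuclideanSpace ℝ (Fin n))),
    ← radialFunction_eq_inv_gauge hKc hKk hK0 (ne_zero_of_mem_unit_sphere u), ← div_eq_mul_inv] at h

/-- Keeps the arguments of ψ and φ in compact subintervals of (0, ∞), so all integrands are bounded
multiples of integrable weights. -/
theorem exists_supportFunction_gradient_gauge_mem_Icc (hn : 1 ≤ n) (hKc : Convex ℝ K)
    (hKk : IsCompact K) (hK0 : K ∈ 𝓝 0) (hLc : Convex ℝ L) (hLk : IsCompact L) (hL0 : L ∈ 𝓝 0) :
    ∃ a b : ℝ, 0 < a ∧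
      ∀ᵐ u : Metric.sphere (0 : EuclideanSpace ℝ (Fin n)) 1 ∂(volume : Measure _).toSphere,
        supportFunction L (gradient (gauge K) (u : EuclideanSpace ℝ (Fin n))) ∈ Icc a b := by
  have : NeZero n := ⟨by omega⟩
  have hKs := isStarBody_of_convex hKc hKk hK0
  have hLs := isStarBody_of_convex hLc hLk hL0
  obtain ⟨b, hb⟩ := exists_supportFunction_gradient_gauge_le hn hKc hK0 hLk
    ⟨0, mem_of_mem_nhds hL0⟩
  have hne : (Metric.sphere (0 : EuclideanSpace ℝ (Fin n)) 1).Nonempty :=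
    NormedSpace.sphere_nonempty.2 zero_le_one
  obtain ⟨u₀, hu₀, hmin⟩ := (isCompact_sphere (0 : EuclideanSpace ℝ (Fin n)) 1).exists_isMinOn hne
    (hLs.radial_continuousOn.div hKs.radial_continuousOn fun u hu => (hKs.radial_pos u hu).ne')
  refine ⟨_, b, div_pos (hLs.radial_pos u₀ hu₀) (hKs.radial_pos u₀ hu₀), ?_⟩
  filter_upwards [hb, ae_differentiableAt_gauge hn hKc hK0] with u hu hd
  exact ⟨(hmin u.2).trans
    (radialFunction_div_le_supportFunction hKc hKk hK0 hLc hLk hL0 u hd), hu⟩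

theorem le_volume_real_add_smul {A B : Set (EuclideanSpace ℝ (Fin n))} (hA : IsCompact A)
    (hB : IsCompact B) {k t : ℝ} (hk : 0 < k) (hAk : volume.real A = k) (hBk : volume.real B = k)
    (ht0 : 0 < t) (ht1 : t < 1) : k ≤ volume.real ((1 - t) • A + t • B) := by
  have h := volume_rpow_mul_volume_rpow_le (sub_pos.2 ht1) ht0 (sub_add_cancel 1 t) hA hB
  have h2 := ENNReal.toReal_mono ((hA.smul (1 - t)).add (hB.smul t)).measure_ne_top h
  rw [ENNReal.toReal_mul, ← ENNReal.toReal_rpow, ← ENNReal.toReal_rpow] at h2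
  change volume.real A ^ (1 - t) * volume.real B ^ t ≤ _ at h2
  rwa [hAk, hBk, ← Real.rpow_add hk, sub_add_cancel, Real.rpow_one] at h2

/-- Minkowski's first inequality. -/
theorem minkowski_first_inequality (hn : 1 ≤ n) (hKc : Convex ℝ K) (hKk : IsCompact K)
    (hK0 : K ∈ 𝓝 0) (hLc : Convex ℝ L) (hLk : IsCompact L) (hL0 : L ∈ 𝓝 0) :
    (volume.real L / volume.real K) ^ (1 / (n : ℝ)) *
      ∫ u : Metric.sphere (0 : EuclideanSpace ℝ (Fin n)) 1,
        radialFunction K (u : EuclideanSpace ℝ (Fin n)) ^ n ∂(volume : Measure _).toSphere ≤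
    ∫ u : Metric.sphere (0 : EuclideanSpace ℝ (Fin n)) 1,
        supportFunction L (gradient (gauge K) (u : EuclideanSpace ℝ (Fin n))) *
        radialFunction K (u : EuclideanSpace ℝ (Fin n)) ^ n ∂(volume : Measure _).toSphere := by
  have hn0 : (0 : ℝ) < n := by exact_mod_cast hn
  have hKs := isStarBody_of_convex hKc hKk hK0
  have hLs := isStarBody_of_convex hLc hLk hL0
  have hk := hKs.volume_real_pos hn
  have hl := hLs.volume_real_pos hn
  obtain ⟨a, b, ha, hab⟩ :=
    exists_supportFunction_gradient_gauge_mem_Icc hn hKc hKk hK0 hLc hLk hL0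
  have hKvol := hKs.volume_real hn
  set σ := (volume : Measure (EuclideanSpace ℝ (Fin n))).toSphere
  set G : Metric.sphere (0 : EuclideanSpace ℝ (Fin n)) 1 → ℝ := fun u =>
    supportFunction L (gradient (gauge K) (u : EuclideanSpace ℝ (Fin n))) with hG
  set w : Metric.sphere (0 : EuclideanSpace ℝ (Fin n)) 1 → ℝ := fun u =>
    radialFunction K (u : EuclideanSpace ℝ (Fin n)) ^ n with hw
  have hGm : Measurable G :=
    (measurable_supportFunction_gradient_gauge hLk).comp measurable_subtype_coe
  have hG0 : ∀ u, 0 ≤ G u := fun u => supportFunction_nonneg hLk (mem_of_mem_nhds hL0)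
  have hwc : Continuous w := hKs.continuous_radialFunction.pow n
  have hwi : Integrable w σ := integrable_toSphere_of_continuous hwc
  have hw0 : ∀ u, 0 < w u := fun u => pow_pos (hKs.radialFunction_pos u) n
  have hGw : Integrable (fun u => G u * w u) σ := by
    refine hwi.bdd_mul hGm.aestronglyMeasurable (c := b) ?_
    filter_upwards [hab] with u hu
    rw [Real.norm_of_nonneg (hG0 u)]
    exact hu.2
  set k := volume.real K
  set l := volume.real L
  set m := (l / k) ^ (1 / (n : ℝ)) with hm
  have hm0 : 0 < m := by positivity
  have hmn : m ^ n = l / k := by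
    rw [hm, ← Real.rpow_natCast, ← Real.rpow_mul (by positivity), one_div,
      inv_mul_cancel₀ hn0.ne', Real.rpow_one]
  obtain ⟨C, hC, hpow⟩ := exists_one_add_mul_pow_le n (B := |m⁻¹ * b|) (abs_nonneg _)
  -- The factor m⁻¹ gives m⁻¹L the volume of K, so (1-t)K + t m⁻¹L has at least that volume.
  have key : ∀ t : ℝ, 0 < t → t < 1 →
      0 ≤ n * (m⁻¹ * (∫ u, G u * w u ∂σ) - ∫ u, w u ∂σ) + C * (∫ u, w u ∂σ) * t := by
    intro t ht0 ht1
    have hsL : volume.real (m⁻¹ • L) = k := by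
      rw [measureReal_def, Measure.addHaar_smul, ENNReal.toReal_mul, finrank_euclideanSpace_fin,
        abs_of_pos (by positivity), ENNReal.toReal_ofReal (by positivity), inv_pow, hmn]
      change (l / k)⁻¹ * l = k
      field_simp
    have h1 := le_volume_real_add_smul hKk (hLk.smul m⁻¹) hk rfl hsL ht0 ht1
    -- A point τu of the combination, paired with the gradient at u, satisfies τ gauge_K(u) ≤ (1-t)
    -- + t m⁻¹G(u); hence τ ≤ R(u).
    set R : Metric.sphere (0 : EuclideanSpace ℝ (Fin n)) 1 → ℝ := fun u =>
      radialFunction K (u : EuclideanSpace ℝ (Fin n)) * (1 + t * (m⁻¹ * G u - 1)) with hR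
    have hRm : Measurable R := hKs.continuous_radialFunction.measurable.mul
      (((hGm.const_mul _).sub_const _).const_mul _ |>.const_add _)
    have hfac : ∀ u, 0 < 1 + t * (m⁻¹ * G u - 1) := fun u => by
      have : 0 ≤ t * (m⁻¹ * G u) := mul_nonneg ht0.le (mul_nonneg (by positivity) (hG0 u))
      linarith
    have hR0 : ∀ u, 0 < R u := fun u => mul_pos (hKs.radialFunction_pos u) (hfac u)
    have hbound : ∀ᵐ u ∂σ,
        R u ^ n ≤ (1 + n * (t * (m⁻¹ * G u - 1)) + C * t ^ 2) * w u := by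
      filter_upwards [hab] with u hu
      rw [hR, mul_pow, mul_comm]
      refine mul_le_mul_of_nonneg_right ?_ (hw0 u).le
      refine hpow t _ ht0.le ht1.le ?_ ?_
      · have := mul_nonneg (inv_pos.2 hm0).le (hG0 u)
        linarith
      · have := mul_le_mul_of_nonneg_left hu.2 (inv_pos.2 hm0).le
        linarith [le_abs_self (m⁻¹ * b)]
    have hexp : (fun u => (1 + n * (t * (m⁻¹ * G u - 1)) + C * t ^ 2) * w u) =
        fun u => (n * t * m⁻¹) * (G u * w u) + (1 - n * t + C * t ^ 2) * w u := by
      ext u; ring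
    have hri := (hGw.const_mul (n * t * m⁻¹)).add (hwi.const_mul (1 - n * t + C * t ^ 2))
    have hRi : Integrable (fun u => R u ^ n) σ := by
      refine hri.mono' (hRm.pow_const n).aestronglyMeasurable ?_
      filter_upwards [hbound] with u hu
      rw [Real.norm_of_nonneg (pow_nonneg (hR0 u).le n)]
      exact hu.trans_eq (congrFun hexp u)
    have h2 : n * volume.real ((1 - t) • K + t • m⁻¹ • L) ≤ ∫ u, R u ^ n ∂σ := by
      refine volume_real_le_integral hn hRm hR0 hRi ?_
      filter_upwards [ae_differentiableAt_gauge hn hKc hK0] with u hd τ hτ hmem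
      obtain ⟨_, ⟨x, hx, rfl⟩, _, ⟨_, ⟨y, hy, rfl⟩, rfl⟩, hxy⟩ := hmem
      have hxy' := congrArg (inner ℝ (gradient (gauge K) (u : EuclideanSpace ℝ (Fin n)))) hxy
      have h3 : inner ℝ (gradient (gauge K) (u : EuclideanSpace ℝ (Fin n))) x ≤ 1 :=
        (inner_le_supportFunction hKk hx).trans_eq
          (supportFunction_gradient_gauge hKc hKk hK0 (ne_zero_of_mem_unit_sphere u) hd)
      have h4 : inner ℝ (gradient (gauge K) (u : EuclideanSpace ℝ (Fin n))) y ≤ G u :=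
        inner_le_supportFunction hLk hy
      simp only [inner_add_right, inner_smul_right] at hxy'
      rw [inner_gradient_gauge (u : EuclideanSpace ℝ (Fin n)), fderiv_gauge_apply_self hd] at hxy'
      have hg := gauge_pos_of_isCompact hKk hK0 (ne_zero_of_mem_unit_sphere u)
      simp only [hR, radialFunction_eq_inv_gauge hKc hKk hK0 (ne_zero_of_mem_unit_sphere u)]
      rw [inv_mul_eq_div, le_div_iff₀ hg, ← hxy']
      have h5 := mul_le_mul_of_nonneg_left h3 (sub_pos.2 ht1).le
      have h6 := mul_le_mul_of_nonneg_left
        (mul_le_mul_of_nonneg_left h4 (inv_pos.2 hm0).le) ht0.le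
      linarith
    have h3 := integral_mono_ae hRi hri (hbound.mono fun u hu => hu.trans_eq (congrFun hexp u))
    have h4 := integral_add (hGw.const_mul (n * t * m⁻¹)) (hwi.const_mul (1 - n * t + C * t ^ 2))
    simp only [integral_const_mul] at h4
    have h5 : (n : ℝ) * k ≤ n * volume.real ((1 - t) • K + t • m⁻¹ • L) := by gcongr
    rw [hKvol] at h5
    have h6 := (h5.trans h2).trans (h3.trans_eq h4)
    -- The zeroth-order terms cancel; dividing by t leaves the first-order term plus an O(t) error,
    -- which vanishes as t → 0+.
    refine nonneg_of_mul_nonneg_right (a := t) ?_ ht0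
    linarith
  have hlim : Tendsto (fun t : ℝ => n * (m⁻¹ * (∫ u, G u * w u ∂σ) - ∫ u, w u ∂σ) +
      C * (∫ u, w u ∂σ) * t) (𝓝[>] 0)
      (𝓝 (n * (m⁻¹ * (∫ u, G u * w u ∂σ) - ∫ u, w u ∂σ) + C * (∫ u, w u ∂σ) * 0)) := by
    refine Tendsto.mono_left (Continuous.tendsto ?_ 0) nhdsWithin_le_nhds
    fun_prop
  have hfin := ge_of_tendsto hlim (by
    filter_upwards [self_mem_nhdsWithin, nhdsWithin_le_nhds (gt_mem_nhds (zero_lt_one' ℝ))]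
      with t ht0 ht1 using key t ht0 ht1)
  rw [mul_zero, add_zero] at hfin
  have := nonneg_of_mul_nonneg_right hfin hn0
  rwa [sub_nonneg, le_inv_mul_iff₀ hm0] at this

end Minkowski

/-! ### The two Jensen inequalities combined. -/

section Composition

variable {α : Type*} [MeasurableSpace α] {μ : Measure α} {φ : ℝ → ℝ} {f w : α → ℝ}

/-- For x < y, the point x lies strictly between x/2 and y, so φ(x) < max(φ(x/2), φ(y)) = φ(y). -/
theorem strictMonoOn_of_strictConvexOn (hφ : StrictConvexOn ℝ (Ioi 0) φ)
    (hm : MonotoneOn φ (Ioi 0)) : StrictMonoOn φ (Ioi 0) := by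
  intro x hx y hy hxy
  have hx' : (0 : ℝ) < x := hx
  have h0 : x / 2 ∈ Ioi (0 : ℝ) := half_pos hx'
  have h1 : x / 2 < x := half_lt_self hx'
  have h := hφ.lt_on_openSegment h0 hy (h1.trans hxy).ne
    (openSegment_eq_Ioo (h1.trans hxy) ▸ ⟨h1, hxy⟩ : x ∈ openSegment ℝ (x / 2) y)
  rwa [max_eq_right (hm h0 hy (h1.trans hxy).le)] at h

theorem aemeasurable_comp_of_continuousOn (hφ : ContinuousOn φ (Ioi 0)) (hf : AEMeasurable f μ)
    (hf0 : ∀ᵐ x ∂μ, 0 < f x) : AEMeasurable (fun x => φ (f x)) μ := by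
  classical
  have h1 : Measurable ((Ioi (0 : ℝ)).piecewise φ 0) :=
    hφ.measurable_piecewise continuousOn_const measurableSet_Ioi
  refine (h1.comp_aemeasurable hf).congr ?_
  filter_upwards [hf0] with x hx
  exact piecewise_eq_of_mem _ _ _ hx

theorem comp_mem_Icc (hm : MonotoneOn φ (Ioi 0)) {a b : ℝ} (ha : 0 < a)
    (hf : ∀ᵐ x ∂μ, f x ∈ Icc a b) : ∀ᵐ x ∂μ, φ (f x) ∈ Icc (φ a) (φ b) := by
  filter_upwards [hf] with x hx
  have h1 : 0 < f x := ha.trans_le hx.1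
  exact ⟨hm ha h1 hx.1, hm h1 (h1.trans_le hx.2) hx.2⟩

theorem integrable_mul_of_mem_Icc (hf : AEMeasurable f μ) {a b : ℝ}
    (hab : ∀ᵐ x ∂μ, f x ∈ Icc a b) (hw : Integrable w μ) :
    Integrable (fun x => f x * w x) μ := by
  refine hw.bdd_mul hf.aestronglyMeasurable (c := max |a| |b|) ?_
  filter_upwards [hab] with x hx
  exact abs_le_max_abs_abs hx.1 hx.2

theorem integrable_comp_mul (hφ : ConvexOn ℝ (Ioi 0) φ) (hm : MonotoneOn φ (Ioi 0))
    (hf : AEMeasurable f μ) {a b : ℝ} (ha : 0 < a) (hab : ∀ᵐ x ∂μ, f x ∈ Icc a b)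
    (hw : Integrable w μ) : Integrable (fun x => φ (f x) * w x) μ :=
  integrable_mul_of_mem_Icc
    (aemeasurable_comp_of_continuousOn (hφ.continuousOn isOpen_Ioi) hf
      (hab.mono fun _ hx => ha.trans_le hx.1))
    (comp_mem_Icc hm ha hab) hw

variable {ψ : ℝ → ℝ} {q : α → ℝ} {a b a' b' m : ℝ}

/-- The average of `f` with weight `w` is at least `m`, hence the average of `ψ (f x) * r x` with
weight `q`, where `r x * q x = w x`, is at least `ψ m * ∫ w / ∫ q`. -/
theorem map_map_mul_integral_le
    (hψpos : ∀ t : ℝ, 0 < t → 0 < ψ t) (hφm : MonotoneOn φ (Ioi 0)) (hψm : MonotoneOn ψ (Ioi 0))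
    (hφ : ConvexOn ℝ (Ioi 0) φ) (hψ : ConvexOn ℝ (Ioi 0) ψ) {r : α → ℝ}
    (hf : AEMeasurable f μ) (ha : 0 < a) (hab : ∀ᵐ x ∂μ, f x ∈ Icc a b)
    (hr : AEMeasurable r μ) (ha' : 0 < a') (hab' : ∀ᵐ x ∂μ, r x ∈ Icc a' b')
    (hw : Integrable w μ) (hq : Integrable q μ) (hw0 : ∀ x, 0 < w x) (hq0 : ∀ x, 0 < q x)
    (hwI : 0 < ∫ x, w x ∂μ) (hqI : 0 < ∫ x, q x ∂μ) (hrq : ∀ x, r x * q x = w x) (hm : 0 < m)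
    (hmf : m * ∫ x, w x ∂μ ≤ ∫ x, f x * w x ∂μ) :
    φ ((∫ x, w x ∂μ) / (∫ x, q x ∂μ) * ψ m) * ∫ x, q x ∂μ ≤ ∫ x, φ (ψ (f x) * r x) * q x ∂μ ∧
    (StrictConvexOn ℝ (Ioi 0) φ → StrictConvexOn ℝ (Ioi 0) ψ →
      ∫ x, φ (ψ (f x) * r x) * q x ∂μ =
        φ ((∫ x, w x ∂μ) / (∫ x, q x ∂μ) * ψ m) * ∫ x, q x ∂μ →
      (∀ᵐ x ∂μ, f x = m) ∧ ∀ᵐ x ∂μ, r x = (∫ x, w x ∂μ) / (∫ x, q x ∂μ)) := by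
  have hf0 : ∀ᵐ x ∂μ, 0 < f x := hab.mono fun _ hx => ha.trans_le hx.1
  have hr0 : ∀ᵐ x ∂μ, 0 < r x := hab'.mono fun _ hx => ha'.trans_le hx.1
  have hψf : AEMeasurable (fun x => ψ (f x)) μ :=
    aemeasurable_comp_of_continuousOn (hψ.continuousOn isOpen_Ioi) hf hf0
  have hψab := comp_mem_Icc hψm ha hab
  have hψa := hψpos a ha
  have hfw := integrable_mul_of_mem_Icc hf hab hw
  have hψw := integrable_mul_of_mem_Icc hψf hψab hw
  have hgab : ∀ᵐ x ∂μ, ψ (f x) * r x ∈ Icc (ψ a * a') (ψ b * b') := by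
    filter_upwards [hψab, hab'] with x h1 h2
    exact ⟨mul_le_mul h1.1 h2.1 ha'.le (hψa.le.trans h1.1),
      mul_le_mul h1.2 h2.2 (ha'.le.trans h2.1) (hψa.le.trans (h1.1.trans h1.2))⟩
  have hg0 : ∀ᵐ x ∂μ, 0 < ψ (f x) * r x := hgab.mono fun _ hx => (mul_pos hψa ha').trans_le hx.1
  have hgq : (fun x => ψ (f x) * r x * q x) = fun x => ψ (f x) * w x := by
    ext x; rw [mul_assoc, hrq]
  have hgqi : Integrable (fun x => ψ (f x) * r x * q x) μ := hgq ▸ hψw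
  have hφq := integrable_comp_mul hφ hφm (hψf.mul hr) (mul_pos hψa ha') hgab hq
  simp only [Pi.mul_apply] at hφq
  set W := ∫ x, w x ∂μ
  set q₀ := ∫ x, q x ∂μ
  -- Inner Jensen, for ψ: c₁ is the w-mean of f, and c₁ ≥ m by hypothesis.
  have hc1 : ∫ x, f x * w x ∂μ = (∫ x, f x * w x ∂μ) / W * W := by field_simp
  have hmc1 : m ≤ (∫ x, f x * w x ∂μ) / W := (le_div_iff₀ hwI).2 hmf
  set c₁ := (∫ x, f x * w x ∂μ) / W
  have hc10 : 0 < c₁ := hm.trans_le hmc1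
  have j1 := map_mul_integral_le hψ hc10 (ae_of_all _ hw0) hf0 hw hfw hψw hc1
  have hψmc := hψm hm hc10 hmc1
  have j2 : ψ m * W ≤ ∫ x, ψ (f x) * w x ∂μ :=
    (mul_le_mul_of_nonneg_right hψmc hwI.le).trans j1
  -- Outer Jensen, for φ: the q-mean of ψ(f)r is the integral of ψ(f)w divided by that of q.
  have hc2 : ∫ x, ψ (f x) * r x * q x ∂μ = (∫ x, ψ (f x) * w x ∂μ) / q₀ * q₀ := by
    rw [hgq]; field_simp
  have hψm0 := hψpos m hm
  have hc00 : 0 < W / q₀ * ψ m := by positivity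
  have hcc : W / q₀ * ψ m ≤ (∫ x, ψ (f x) * w x ∂μ) / q₀ := by
    rw [div_mul_eq_mul_div, mul_comm W]
    exact div_le_div_of_nonneg_right j2 hqI.le
  have hc20 := hc00.trans_le hcc
  have j3 := map_mul_integral_le hφ hc20 (ae_of_all _ hq0) hg0 hq hgqi hφq hc2
  have hφcc := hφm hc00 hc20 hcc
  refine ⟨(mul_le_mul_of_nonneg_right hφcc hqI.le).trans j3, fun hφs hψs heq => ?_⟩
  -- Equality at the ends forces equality in every link. Strict monotonicity identifies the means,
  -- giving c₁ = m, and strict Jensen makes f and ψ(f)r constant; dividing by ψ(m) isolates r.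
  have e1 : φ ((∫ x, ψ (f x) * w x ∂μ) / q₀) = φ (W / q₀ * ψ m) :=
    le_antisymm (le_of_mul_le_mul_right (j3.trans_eq heq) hqI) hφcc
  have e2 := (strictMonoOn_of_strictConvexOn hφs hφm).injOn hc20 hc00 e1
  have e3 := ae_eq_of_map_mul_integral_eq hφs hc20 (ae_of_all _ hq0) hg0 hq hgqi hφq hc2
    (by rw [heq, e1])
  have e4 : ∫ x, ψ (f x) * w x ∂μ = ψ m * W := by
    rw [div_eq_iff hqI.ne'] at e2
    rw [e2]; field_simp
  have e5 : ψ c₁ = ψ m := le_antisymm (le_of_mul_le_mul_right (j1.trans_eq e4) hwI) hψmc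
  have e6 := (strictMonoOn_of_strictConvexOn hψs hψm).injOn hc10 hm e5
  have e7 := ae_eq_of_map_mul_integral_eq hψs hc10 (ae_of_all _ hw0) hf0 hw hfw hψw hc1
    (by rw [e4, e5])
  rw [e6] at e7
  refine ⟨e7, ?_⟩
  filter_upwards [e3, e7] with x h1 h2
  rw [h2, e2, mul_comm] at h1
  exact mul_right_cancel₀ hψm0.ne' h1

end Composition

/-! ### Dilatates, the equality case and the theorem. -/

section Main

variable {n : ℕ} {K L Q : Set (EuclideanSpace ℝ (Fin n))}

theorem supportFunction_smul_set {c : ℝ} (hc : 0 ≤ c) (v : EuclideanSpace ℝ (Fin n)) :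
    supportFunction (c • K) v = c * supportFunction K v := by
  rw [supportFunction, supportFunction, ← smul_eq_mul, ← Real.sSup_smul_of_nonneg hc,
    ← image_smul, ← image_smul, image_image, image_image]
  simp only [inner_smul_right, smul_eq_mul]

theorem radialFunction_smul_set {c : ℝ} (hc : 0 < c) (u : EuclideanSpace ℝ (Fin n)) :
    radialFunction (c • K) u = c * radialFunction K u := by
  rw [radialFunction, radialFunction, ← smul_eq_mul, ← Real.sSup_smul_of_nonneg hc.le]
  congr 1
  ext t
  rw [mem_smul_set_iff_inv_smul_mem₀ hc.ne']
  simp only [mem_ofPred_eq, mem_smul_set_iff_inv_smul_mem₀ hc.ne', smul_smul, smul_eq_mul]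
  exact and_congr_left fun _ => by simp [hc]

theorem volume_real_smul {c : ℝ} (hc : 0 < c) :
    volume.real (c • K) = c ^ n * volume.real K := by
  rw [measureReal_def, Measure.addHaar_smul, ENNReal.toReal_mul, finrank_euclideanSpace_fin,
    abs_of_pos (by positivity), ENNReal.toReal_ofReal (by positivity)]
  rfl

theorem mixedVolume_eq (hn : 1 ≤ n) (hKc : Convex ℝ K) (hKk : IsCompact K) (hK0 : K ∈ 𝓝 0)
    (φ ψ : ℝ → ℝ) :
    n * mixedVolume φ ψ K L Q = ∫ u : Metric.sphere (0 : EuclideanSpace ℝ (Fin n)) 1,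
      φ (ψ (supportFunction L (gradient (gauge K) (u : EuclideanSpace ℝ (Fin n)))) *
        (radialFunction K (u : EuclideanSpace ℝ (Fin n)) / radialFunction Q u) ^ n) *
        radialFunction Q (u : EuclideanSpace ℝ (Fin n)) ^ n ∂(volume : Measure _).toSphere := by
  have hn0 : (n : ℝ) ≠ 0 := by exact_mod_cast (by omega : n ≠ 0)
  rw [mixedVolume, ← mul_assoc, mul_one_div_cancel hn0, one_mul]
  refine integral_congr_ae ?_
  filter_upwards [ae_differentiableAt_gauge hn hKc hK0] with u hu
  rw [supportFunction_div_radialGaussMap hKc hKk hK0 u hu]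

/-- The ratio of support functions is c and that of radial functions is 1/d, so the integrand is a
constant times `ρ_K^n`. -/
theorem mixedVolume_of_dilatates (hn : 1 ≤ n) (hKc : Convex ℝ K) (hKk : IsCompact K)
    (hK0 : K ∈ 𝓝 0) (φ ψ : ℝ → ℝ) {c d : ℝ} (hc : 0 < c) (hd : 0 < d) :
    mixedVolume φ ψ K (c • K) (d • K) =
      φ (volume.real K / volume.real (d • K) *
        ψ ((volume.real (c • K) / volume.real K) ^ (1 / (n : ℝ)))) * volume.real (d • K) := by
  have hn0 : (n : ℝ) ≠ 0 := by exact_mod_cast (by omega : n ≠ 0)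
  have hKs := isStarBody_of_convex hKc hKk hK0
  have hk := hKs.volume_real_pos hn
  have h1 := mixedVolume_eq (L := c • K) (Q := d • K) hn hKc hKk hK0 φ ψ
  have h2 : ∫ u : Metric.sphere (0 : EuclideanSpace ℝ (Fin n)) 1,
      φ (ψ (supportFunction (c • K) (gradient (gauge K) (u : EuclideanSpace ℝ (Fin n)))) *
        (radialFunction K (u : EuclideanSpace ℝ (Fin n)) / radialFunction (d • K) u) ^ n) *
        radialFunction (d • K) (u : EuclideanSpace ℝ (Fin n)) ^ n ∂(volume : Measure _).toSphere =
      ∫ u : Metric.sphere (0 : EuclideanSpace ℝ (Fin n)) 1, (φ (ψ c * (1 / d) ^ n) * d ^ n) *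
        radialFunction K (u : EuclideanSpace ℝ (Fin n)) ^ n ∂(volume : Measure _).toSphere := by
    refine integral_congr_ae ?_
    filter_upwards [ae_differentiableAt_gauge hn hKc hK0] with u hu
    have hρ := hKs.radialFunction_pos u
    have e : radialFunction K (u : EuclideanSpace ℝ (Fin n)) / (d * radialFunction K u) =
        1 / d := by field_simp
    rw [supportFunction_smul_set hc.le, radialFunction_smul_set hd, e, mul_pow,
      supportFunction_gradient_gauge hKc hKk hK0 (ne_zero_of_mem_unit_sphere u) hu, mul_one,
      mul_assoc]
  rw [h2, integral_const_mul, ← hKs.volume_real hn] at h1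
  refine mul_left_cancel₀ hn0 (h1.trans ?_)
  have e1 : volume.real K / (d ^ n * volume.real K) = (1 / d) ^ n := by
    rw [one_div, inv_pow]; field_simp
  have e2 : (c ^ n * volume.real K / volume.real K) ^ (1 / (n : ℝ)) = c := by
    rw [mul_div_cancel_right₀ _ hk.ne', ← Real.rpow_natCast, ← Real.rpow_mul hc.le,
      mul_one_div_cancel hn0, Real.rpow_one]
  rw [volume_real_smul hc, volume_real_smul hd, e1, e2, mul_comm ((1 / d) ^ n)]
  ring

/-- Continuous functions on the sphere which agree almost everywhere agree. -/
theorem eq_of_ae_eq_toSphere {f g : Metric.sphere (0 : EuclideanSpace ℝ (Fin n)) 1 → ℝ}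
    (hf : Continuous f) (hg : Continuous g)
    (h : ∀ᵐ u ∂(volume : Measure (EuclideanSpace ℝ (Fin n))).toSphere, f u = g u) (u) :
    f u = g u :=
  congrFun ((Continuous.ae_eq_iff_eq _ hf hg).1 h) u

/-- If the support function of `L` is `m` times that of `K` in almost all normal directions of `K`,
and the volumes are compatible with this, then `L = m • K`. -/
theorem eq_smul_of_supportFunction_ae_eq (hn : 1 ≤ n) (hKc : Convex ℝ K) (hKk : IsCompact K)
    (hK0 : K ∈ 𝓝 0) (hLc : Convex ℝ L) (hLk : IsCompact L) (hL0 : L ∈ 𝓝 0) {m : ℝ} (hm : 0 < m)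
    (hvol : volume.real L = m ^ n * volume.real K)
    (h : ∀ᵐ u : Metric.sphere (0 : EuclideanSpace ℝ (Fin n)) 1 ∂(volume : Measure _).toSphere,
      supportFunction L (gradient (gauge K) (u : EuclideanSpace ℝ (Fin n))) = m) :
    L = m • K := by
  have hKs := isStarBody_of_convex hKc hKk hK0
  have hLs := isStarBody_of_convex hLc hLk hL0
  have hKr := hKs.continuous_radialFunction
  have hLr := hLs.continuous_radialFunction
  refine hKs.eq_smul hLs hKk.isClosed hLk.isClosed hm ?_
  -- An almost-everywhere inequality between functions with equal integrals is an equality almost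
  -- everywhere, and everywhere by continuity.
  have hle : ∀ᵐ u : Metric.sphere (0 : EuclideanSpace ℝ (Fin n)) 1
      ∂(volume : Measure _).toSphere,
      radialFunction L (u : EuclideanSpace ℝ (Fin n)) ^ n ≤ (m * radialFunction K u) ^ n := by
    filter_upwards [h, ae_differentiableAt_gauge hn hKc hK0] with u hu hd
    have h1 := radialFunction_div_le_supportFunction hKc hKk hK0 hLc hLk hL0 u hd
    rw [hu, div_le_iff₀ (hKs.radialFunction_pos u)] at h1
    exact pow_le_pow_left₀ (hLs.radialFunction_pos u).le h1 n
  have hi1 := integrable_toSphere_of_continuous (hLr.pow n)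
  have hi2 := integrable_toSphere_of_continuous ((hKr.const_mul m).pow n)
  have hint : ∫ u : Metric.sphere (0 : EuclideanSpace ℝ (Fin n)) 1,
      radialFunction L (u : EuclideanSpace ℝ (Fin n)) ^ n ∂(volume : Measure _).toSphere =
      ∫ u : Metric.sphere (0 : EuclideanSpace ℝ (Fin n)) 1,
        (m * radialFunction K (u : EuclideanSpace ℝ (Fin n))) ^ n
          ∂(volume : Measure _).toSphere := by
    simp only [mul_pow]
    rw [integral_const_mul, ← hKs.volume_real hn, ← hLs.volume_real hn, hvol]
    ring
  have hae := (integral_eq_iff_of_ae_le hi1 hi2 hle).1 hint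
  have heq := eq_of_ae_eq_toSphere (hLr.pow n) ((hKr.const_mul m).pow n) hae
  intro u
  exact (pow_left_inj₀ (hLs.radialFunction_pos u).le
    (mul_pos hm (hKs.radialFunction_pos u)).le (by omega)).1 (heq u)

end Main

end DualOrlicz

theorem mainTheorem7 (n : ℕ) (hn : 1 ≤ n)
    (K L : ConvexBody (EuclideanSpace ℝ (Fin n))) (Q : Set (EuclideanSpace ℝ (Fin n)))
    (hK : (0 : EuclideanSpace ℝ (Fin n)) ∈ interior (K : Set (EuclideanSpace ℝ (Fin n))))
    (hL : (0 : EuclideanSpace ℝ (Fin n)) ∈ interior (L : Set (EuclideanSpace ℝ (Fin n))))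
    (hQ : DualOrlicz.IsStarBody Q)
    (φ ψ : ℝ → ℝ)
    (hφpos : ∀ t : ℝ, 0 < t → 0 < φ t) (hψpos : ∀ t : ℝ, 0 < t → 0 < ψ t)
    (hφmono : MonotoneOn φ (Set.Ioi 0)) (hψmono : MonotoneOn ψ (Set.Ioi 0))
    (hφconv : ConvexOn ℝ (Set.Ioi 0) φ) (hψconv : ConvexOn ℝ (Set.Ioi 0) ψ) :
    DualOrlicz.mixedVolume φ ψ K L Q ≥
        φ (volume.real (K : Set (EuclideanSpace ℝ (Fin n))) / volume.real Q *
            ψ ((volume.real (L : Set (EuclideanSpace ℝ (Fin n))) /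
              volume.real (K : Set (EuclideanSpace ℝ (Fin n)))) ^ (1 / (n : ℝ)))) *
          volume.real Q ∧
      (StrictConvexOn ℝ (Set.Ioi 0) φ → StrictConvexOn ℝ (Set.Ioi 0) ψ → IsClosed Q →
        (DualOrlicz.mixedVolume φ ψ K L Q =
            φ (volume.real (K : Set (EuclideanSpace ℝ (Fin n))) / volume.real Q *
                ψ ((volume.real (L : Set (EuclideanSpace ℝ (Fin n))) /
                  volume.real (K : Set (EuclideanSpace ℝ (Fin n)))) ^ (1 / (n : ℝ)))) *
              volume.real Q ↔
          DualOrlicz.AreDilatates (K : Set (EuclideanSpace ℝ (Fin n))) L ∧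
            DualOrlicz.AreDilatates (K : Set (EuclideanSpace ℝ (Fin n))) Q ∧
            DualOrlicz.AreDilatates (L : Set (EuclideanSpace ℝ (Fin n))) Q)) := by
  open DualOrlicz in
  have hn0 : (0 : ℝ) < n := by exact_mod_cast hn
  have : NeZero n := ⟨by omega⟩
  have hKc := K.convex
  have hKk := K.isCompact
  have hK0 := mem_interior_iff_mem_nhds.1 hK
  have hLc := L.convex
  have hLk := L.isCompact
  have hL0 := mem_interior_iff_mem_nhds.1 hL
  generalize (K : Set (EuclideanSpace ℝ (Fin n))) = K at *
  generalize (L : Set (EuclideanSpace ℝ (Fin n))) = L at *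
  have hKs := isStarBody_of_convex hKc hKk hK0
  have hLs := isStarBody_of_convex hLc hLk hL0
  have hKr := hKs.continuous_radialFunction
  have hQr := hQ.continuous_radialFunction
  have hk := hKs.volume_real_pos hn
  have hl := hLs.volume_real_pos hn
  obtain ⟨a, b, ha, hab⟩ :=
    exists_supportFunction_gradient_gauge_mem_Icc hn hKc hKk hK0 hLc hLk hL0
  have hratio : Continuous fun u : Metric.sphere (0 : EuclideanSpace ℝ (Fin n)) 1 =>
      (radialFunction K (u : EuclideanSpace ℝ (Fin n)) / radialFunction Q u) ^ n :=
    (hKr.div hQr fun u => (hQ.radialFunction_pos u).ne').pow n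
  have hratio0 : ∀ u : Metric.sphere (0 : EuclideanSpace ℝ (Fin n)) 1,
      0 < radialFunction K (u : EuclideanSpace ℝ (Fin n)) / radialFunction Q u := fun u =>
    div_pos (hKs.radialFunction_pos u) (hQ.radialFunction_pos u)
  have hcpt : CompactSpace (Metric.sphere (0 : EuclideanSpace ℝ (Fin n)) 1) :=
    isCompact_iff_compactSpace.1 (isCompact_sphere _ _)
  have hne : Nonempty (Metric.sphere (0 : EuclideanSpace ℝ (Fin n)) 1) :=
    (NormedSpace.sphere_nonempty.2 zero_le_one).to_subtype
  -- The extrema on the compact sphere supply the bounds required of r = (ρ_K/ρ_Q)^n.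
  obtain ⟨u₁, -, hu₁⟩ := isCompact_univ.exists_isMinOn univ_nonempty hratio.continuousOn
  obtain ⟨u₂, -, hu₂⟩ := isCompact_univ.exists_isMaxOn univ_nonempty hratio.continuousOn
  have hm : 0 < (volume.real L / volume.real K) ^ (1 / (n : ℝ)) := by positivity
  have hKvol := hKs.volume_real hn
  have hQvol := hQ.volume_real hn
  have hmix := mixedVolume_eq (L := L) (Q := Q) hn hKc hKk hK0 φ ψ
  obtain ⟨h1, h2⟩ := map_map_mul_integral_le (μ := (volume : Measure _).toSphere)
    (f := fun u : Metric.sphere (0 : EuclideanSpace ℝ (Fin n)) 1 =>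
      supportFunction L (gradient (gauge K) (u : EuclideanSpace ℝ (Fin n))))
    (r := fun u : Metric.sphere (0 : EuclideanSpace ℝ (Fin n)) 1 =>
      (radialFunction K (u : EuclideanSpace ℝ (Fin n)) / radialFunction Q u) ^ n)
    (w := fun u => radialFunction K (u : EuclideanSpace ℝ (Fin n)) ^ n)
    (q := fun u => radialFunction Q (u : EuclideanSpace ℝ (Fin n)) ^ n)
    hψpos hφmono hψmono hφconv hψconv
    ((measurable_supportFunction_gradient_gauge hLk).comp measurable_subtype_coe).aemeasurable
    ha hab hratio.measurable.aemeasurable (pow_pos (hratio0 u₁) n)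
    (ae_of_all _ fun u => ⟨hu₁ (mem_univ u), hu₂ (mem_univ u)⟩)
    (integrable_toSphere_of_continuous (hKr.pow n))
    (integrable_toSphere_of_continuous (hQr.pow n))
    (fun u => pow_pos (hKs.radialFunction_pos u) n) (fun u => pow_pos (hQ.radialFunction_pos u) n)
    (hKs.integral_pow_pos hn) (hQ.integral_pow_pos hn)
    (fun u => by rw [div_pow, div_mul_cancel₀ _ (pow_pos (hQ.radialFunction_pos u) n).ne'])
    hm (minkowski_first_inequality hn hKc hKk hK0 hLc hLk hL0)
  rw [← hmix, ← hKvol, ← hQvol, mul_div_mul_left _ _ hn0.ne', mul_left_comm] at h1 h2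
  refine ⟨le_of_mul_le_mul_left h1 hn0, fun hφs hψs hQc => ⟨fun heq => ?_, ?_⟩⟩
  · obtain ⟨h3, h4⟩ := h2 hφs hψs (by rw [heq])
    have hmn : ((volume.real L / volume.real K) ^ (1 / (n : ℝ))) ^ n =
        volume.real L / volume.real K := by
      rw [← Real.rpow_natCast, ← Real.rpow_mul (by positivity), one_div_mul_cancel hn0.ne',
        Real.rpow_one]
    have hLK := eq_smul_of_supportFunction_ae_eq hn hKc hKk hK0 hLc hLk hL0 hm
      (by rw [hmn]; field_simp) h3
    have hr := eq_of_ae_eq_toSphere hratio continuous_const h4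
    obtain ⟨u₀⟩ := hne
    -- The ratio is the same in all directions, so its value at any one direction gives the dilation
    -- factor.
    set e := radialFunction K (u₀ : EuclideanSpace ℝ (Fin n)) / radialFunction Q u₀ with he
    have he0 : 0 < e := hratio0 u₀
    have hQK : Q = e⁻¹ • K := by
      refine hKs.eq_smul hQ hKk.isClosed hQc (inv_pos.2 he0) fun u => ?_
      have h5 := (pow_left_inj₀ (hratio0 u).le he0.le (by omega)).1 ((hr u).trans (hr u₀).symm)
      rw [div_eq_iff (hQ.radialFunction_pos u).ne'] at h5
      rw [h5, inv_mul_cancel_left₀ he0.ne']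
    generalize (volume.real L / volume.real K) ^ (1 / (n : ℝ)) = m at hm hLK
    refine ⟨⟨m, hm, hLK⟩, ⟨e⁻¹, inv_pos.2 he0, hQK⟩, ⟨e⁻¹ * m⁻¹, by positivity, ?_⟩⟩
    rw [hLK, smul_smul, inv_mul_cancel_right₀ hm.ne', hQK]
  · rintro ⟨⟨c, hc, hLK⟩, ⟨d, hd, hQK⟩, -⟩
    rw [hLK, hQK]
    exact mixedVolume_of_dilatates hn hKc hKk hK0 φ ψ hc hd
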